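/- Let $d\ge 2$, $1<p<\infty$, let $\Omega\subset\mathbb{R}^d$ be a bounded open set and let $D\subset\Omega$ be a nonempty open set with Lipschitz boundary. Let $\sigma\colon\Omega\to\mathbb{R}$ be measurable with $\sigma=1$ on $\Omega\setminus D$, and suppose that there are constants $a,b$ such that either $0<a<\sigma(x)<b<1$ for all $x\in D$, or $1<a<\sigma(x)<b<\infty$ for all $x\in D$. For a conductivity $\gamma$ on $\Omega$ (here $\gamma=\sigma$ or $\gamma=1$) let $X=W^{1,p}(\Omega)/W^{1,p}_0(\Omega)$ and let $\Lambda_\gamma\colon X\to X'$ be the weak Dirichlet to Neumann map $$\langle\Lambda_\gamma f,g\rangle=\int_\Omega\gamma|\nabla u|^{p-2}\nabla u\cdot\nabla\bar g\,dx,$$ where $u\in W^{1,p}(\Omega)$ minimizes $\int_\Omega\gamma|\nabla u|^p\,dx$ among functions with boundary values $f$, and $\bar g\in W^{1,p}(\Omega)$ is any extension of $g$. Let $w\in C^2(\mathbb{R})$ solve $w''+V(w,w')w=0$ on $\mathbb{R}$ with $(w(0),w'(0))\neq(0,0)$, where $$V(a,b)=\frac{(2p-3)b^2+(p-1)a^2}{(p-1)b^2+a^2}.$$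 For $t\in\mathbb{R}$, $\tau>0$ and $\rho,\rho^\perp\in\mathbb{R}^d$ with $|\rho|=|\rho^\perp|=1$ and $\rho\cdot\rho^\perp=0$ (below called an orthonormal pair), let $f(x)=e^{\tau(\rho\cdot x-t)}w(\tau\rho^\perp\cdot x)$ be the corresponding Wolff solution, considered as an element of $X$, and define the indicator function $$I(t,\rho,\rho^\perp,\tau)=\tau^{d-p}\langle(\Lambda_\sigma-\Lambda_1)f,f\rangle .$$ Write $h_D(\rho)=\sup_{x\in D}x\cdot\rho$. Then: 1. There exist constants $c,C,\tau_0>0$ such that for every orthonormal pair $\rho,\rho^\perp$ and every $\tau\ge\tau_0$ $$c<\left|I(h_D(\rho),\rho,\rho^\perp,\tau)\right|<C\tau^d .$$ 2. For every orthonormal pair $\rho,\rho^\perp$: if $t>h_D(\rho)$, then $I(t,\rho,\rho^\perp,\tau)\to0$ as $\tau\to\infty$; if $t<h_D(\rho)$, then $|I(t,\rho,\rho^\perp,\tau)|\to\infty$ as $\tau\to\infty$. 3. Consequently the convex hull of $D$ is determined by the indicator function: it is the interior of the set of all $x\in\mathbb{R}^d$ such that $\rho\cdot x\le t$ for every orthonormal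 pair $\rho,\rho^\perp$ and every $t\in\mathbb{R}$ with $\lim_{\tau\to\infty}I(t,\rho,\rho^\perp,\tau)=0$. -/

import Mathlib

open MeasureTheory Filter Topology
open scoped ContDiff

namespace Enclosure

noncomputable section

/-- Euclidean space `ℝᵈ`. -/
abbrev E (d : ℕ) : Type := EuclideanSpace ℝ (Fin d)

instance factOneLeOfReal {p : ℝ} [hp : Fact (1 < p)] : Fact (1 ≤ ENNReal.ofReal p) :=
  ⟨ENNReal.one_le_ofReal.2 hp.out.le⟩

/-- `φ ∈ C_c^∞(Ω)`. -/
def IsTestFunction {d : ℕ} (Ω : Set (E d)) (φ : E d → ℝ) : Prop :=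
  ContDiff ℝ ∞ φ ∧ HasCompactSupport φ ∧ tsupport φ ⊆ Ω

/-- `G` is the weak gradient of `u` in `Ω`:
`∫_Ω u ∂_v φ = - ∫_Ω (G · v) φ` for all test functions `φ` and all directions `v`. -/
def IsWeakGradient {d : ℕ} (Ω : Set (E d)) (u : E d → ℝ) (G : E d → E d) : Prop :=
  ∀ φ : E d → ℝ, IsTestFunction Ω φ → ∀ v : E d,
    ∫ x in Ω, u x * fderiv ℝ φ x v = - ∫ x in Ω, inner ℝ (G x) v * φ x

theorem integrable_mul_fderiv_test {d : ℕ} {Ω : Set (E d)} {p : ℝ} [Fact (1 < p)]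
    (u : Lp ℝ (ENNReal.ofReal p) (volume.restrict Ω)) {φ : E d → ℝ}
    (hφ : IsTestFunction Ω φ) (v : E d) :
    Integrable (fun x => u x * fderiv ℝ φ x v) (volume.restrict Ω) := by
  have hu : LocallyIntegrable (fun x => u x) (volume.restrict Ω) :=
    (Lp.memLp u).locallyIntegrable Fact.out
  have hc : Continuous (fun x => fderiv ℝ φ x v) :=
    (hφ.1.continuous_fderiv (by simp)).clm_apply continuous_const
  have hs : HasCompactSupport (fun x => fderiv ℝ φ x v) := hφ.2.1.fderiv_apply (𝕜 := ℝ) v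
  have := hu.integrable_smul_left_of_hasCompactSupport hc hs
  simpa [smul_eq_mul, mul_comm] using this

theorem integrable_inner_mul_test {d : ℕ} {Ω : Set (E d)} {p : ℝ} [Fact (1 < p)]
    (G : Lp (E d) (ENNReal.ofReal p) (volume.restrict Ω)) {φ : E d → ℝ}
    (hφ : IsTestFunction Ω φ) (v : E d) :
    Integrable (fun x => inner ℝ (G x) v * φ x) (volume.restrict Ω) := by
  have hG : LocallyIntegrable (fun x => G x) (volume.restrict Ω) :=
    (Lp.memLp G).locallyIntegrable Fact.out
  have := (hG.integrable_smul_left_of_hasCompactSupport hφ.1.continuous hφ.2.1).inner_const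
    (𝕜 := ℝ) v
  simpa [inner_smul_left, mul_comm] using this

/-- The Sobolev space `W^{1,p}(Ω)`, as the space of pairs `(u, ∇u)` in `L^p(Ω) × L^p(Ω; ℝᵈ)`.
Its norm is `max (‖u‖_p, ‖∇u‖_p)`, which is equivalent to the usual Sobolev norm. -/
def W1p {d : ℕ} (Ω : Set (E d)) (p : ℝ) [Fact (1 < p)] :
    Submodule ℝ (Lp ℝ (ENNReal.ofReal p) (volume.restrict Ω) ×
      Lp (E d) (ENNReal.ofReal p) (volume.restrict Ω)) where
  carrier := {v | IsWeakGradient Ω v.1 v.2}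
  zero_mem' := by
    intro φ _ v
    have h1 : ∫ x in Ω, (0 : Lp ℝ (ENNReal.ofReal p) (volume.restrict Ω)) x * fderiv ℝ φ x v = 0 := by
      rw [← integral_zero (E d) ℝ (μ := volume.restrict Ω)]
      refine integral_congr_ae ?_
      filter_upwards [Lp.coeFn_zero ℝ (ENNReal.ofReal p) (volume.restrict Ω)] with x hx
      rw [hx]; simp
    have h2 : ∫ x in Ω,
        inner ℝ ((0 : Lp (E d) (ENNReal.ofReal p) (volume.restrict Ω)) x) v * φ x = 0 := by
      rw [← integral_zero (E d) ℝ (μ := volume.restrict Ω)]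
      refine integral_congr_ae ?_
      filter_upwards [Lp.coeFn_zero (E d) (ENNReal.ofReal p) (volume.restrict Ω)] with x hx
      rw [hx]; simp
    exact h1.trans (by rw [← neg_eq_zero] at h2; exact h2.symm)
  add_mem' := by
    intro a b ha hb φ hφ v
    have h1 : ∫ x in Ω, (a + b).1 x * fderiv ℝ φ x v
        = ∫ x in Ω, (a.1 x * fderiv ℝ φ x v + b.1 x * fderiv ℝ φ x v) := by
      refine integral_congr_ae ?_
      filter_upwards [Lp.coeFn_add a.1 b.1] with x hx
      rw [Prod.fst_add, hx, Pi.add_apply, add_mul]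
    have h2 : ∫ x in Ω, inner ℝ ((a + b).2 x) v * φ x
        = ∫ x in Ω, (inner ℝ (a.2 x) v * φ x + inner ℝ (b.2 x) v * φ x) := by
      refine integral_congr_ae ?_
      filter_upwards [Lp.coeFn_add a.2 b.2] with x hx
      rw [Prod.snd_add, hx, Pi.add_apply, inner_add_left, add_mul]
    rw [h1, h2, integral_add (integrable_mul_fderiv_test _ hφ v) (integrable_mul_fderiv_test _ hφ v),
      integral_add (integrable_inner_mul_test _ hφ v) (integrable_inner_mul_test _ hφ v),
      ha φ hφ v, hb φ hφ v, neg_add]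
  smul_mem' := by
    intro c a ha φ hφ v
    have h1 : ∫ x in Ω, (c • a).1 x * fderiv ℝ φ x v
        = ∫ x in Ω, c * (a.1 x * fderiv ℝ φ x v) := by
      refine integral_congr_ae ?_
      filter_upwards [Lp.coeFn_smul c a.1] with x hx
      rw [Prod.smul_fst, hx, Pi.smul_apply, smul_eq_mul, mul_assoc]
    have h2 : ∫ x in Ω, inner ℝ ((c • a).2 x) v * φ x
        = ∫ x in Ω, c * (inner ℝ (a.2 x) v * φ x) := by
      refine integral_congr_ae ?_
      filter_upwards [Lp.coeFn_smul c a.2] with x hx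
      rw [Prod.smul_snd, hx, Pi.smul_apply, real_inner_smul_left, mul_assoc]
    rw [h1, h2, integral_const_mul, integral_const_mul, ha φ hφ v, mul_neg]

/-- The elements of `W^{1,p}(Ω)` given by test functions. -/
def testSubmodule {d : ℕ} (Ω : Set (E d)) (p : ℝ) [Fact (1 < p)] :
    Submodule ℝ (W1p Ω p) where
  carrier := {v | ∃ φ : E d → ℝ, IsTestFunction Ω φ ∧ v.1.1 =ᵐ[volume.restrict Ω] φ}
  zero_mem' := ⟨fun _ => 0, ⟨contDiff_const, HasCompactSupport.zero, by simp [tsupport]⟩,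
    Lp.coeFn_zero ℝ (ENNReal.ofReal p) (volume.restrict Ω)⟩
  add_mem' := by
    rintro a b ⟨φ, hφ, ha⟩ ⟨ψ, hψ, hb⟩
    refine ⟨φ + ψ, ⟨hφ.1.add hψ.1, hφ.2.1.add hψ.2.1, ?_⟩, ?_⟩
    · exact (tsupport_add φ ψ).trans (Set.union_subset hφ.2.2 hψ.2.2)
    · exact (Lp.coeFn_add a.1.1 b.1.1).trans (ha.add hb)
  smul_mem' := by
    rintro c a ⟨φ, hφ, ha⟩
    refine ⟨c • φ, ⟨hφ.1.const_smul c, hφ.2.1.smul_left (f := fun _ => c), ?_⟩, ?_⟩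
    · exact (tsupport_smul_subset_right (fun _ => c) φ).trans hφ.2.2
    · exact (Lp.coeFn_smul c a.1.1).trans (ha.const_smul c)

/-- `W_0^{1,p}(Ω)`, the closure of `C_c^∞(Ω)` in `W^{1,p}(Ω)`. -/
def W01p {d : ℕ} (Ω : Set (E d)) (p : ℝ) [Fact (1 < p)] : Submodule ℝ (W1p Ω p) :=
  (testSubmodule Ω p).topologicalClosure

/-- The space of abstract boundary values `X = W^{1,p}(Ω) / W_0^{1,p}(Ω)`. -/
abbrev BoundarySpace {d : ℕ} (Ω : Set (E d)) (p : ℝ) [Fact (1 < p)] : Type :=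
  W1p Ω p ⧸ W01p Ω p

/-- The boundary values of an element of `W^{1,p}(Ω)`. -/
def boundaryValue {d : ℕ} (Ω : Set (E d)) (p : ℝ) [Fact (1 < p)] (u : W1p Ω p) :
    BoundarySpace Ω p :=
  Submodule.Quotient.mk u

open Classical in
/-- The boundary values in `X` of a function `f` which belongs to `W^{1,p}(Ω)`
(and `0` when it does not). -/
def boundaryValueOfFun {d : ℕ} (Ω : Set (E d)) (p : ℝ) [Fact (1 < p)] (f : E d → ℝ) :
    BoundarySpace Ω p :=
  if h : ∃ u : W1p Ω p, u.1.1 =ᵐ[volume.restrict Ω] f then boundaryValue Ω p h.choose else 0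

/-- The energy `∫_Ω σ |∇u|^p`. -/
def energy {d : ℕ} (Ω : Set (E d)) (p : ℝ) [Fact (1 < p)] (σ : E d → ℝ) (u : W1p Ω p) : ℝ :=
  ∫ x in Ω, σ x * ‖u.1.2 x‖ ^ p

/-- `u` minimizes the energy among all functions with boundary values `f`. -/
def IsMinimizer {d : ℕ} (Ω : Set (E d)) (p : ℝ) [Fact (1 < p)] (σ : E d → ℝ)
    (f : BoundarySpace Ω p) (u : W1p Ω p) : Prop :=
  boundaryValue Ω p u = f ∧
    ∀ v : W1p Ω p, boundaryValue Ω p v = f → energy Ω p σ u ≤ energy Ω p σ v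

/-- The form `∫_Ω σ |∇u|^{p-2} ∇u · ∇g`. -/
def flux {d : ℕ} (Ω : Set (E d)) (p : ℝ) [Fact (1 < p)] (σ : E d → ℝ) (u g : W1p Ω p) : ℝ :=
  ∫ x in Ω, σ x * ‖u.1.2 x‖ ^ (p - 2) * inner ℝ (u.1.2 x) (g.1.2 x)

/-- The weak Dirichlet to Neumann map `Λ_σ` from `X` to the dual of `X`. For boundary values `f`, the functional
`Λ_σ f` is the one with `⟨Λ_σ f, g⟩ = ∫_Ω σ |∇u|^{p-2} ∇u · ∇ḡ`, where `u` minimizes the energy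
with boundary values `f`, and `ḡ` is any extension of `g`. -/
def dnMap {d : ℕ} (Ω : Set (E d)) (p : ℝ) [Fact (1 < p)] (σ : E d → ℝ)
    (f : BoundarySpace Ω p) : StrongDual ℝ (BoundarySpace Ω p) :=
  Classical.epsilon fun L : StrongDual ℝ (BoundarySpace Ω p) =>
    ∃ u : W1p Ω p, IsMinimizer Ω p σ f u ∧
      ∀ g : W1p Ω p, L (boundaryValue Ω p g) = flux Ω p σ u g

/-- The coefficient `V(a,b) = ((2p-3) b² + (p-1) a²) / ((p-1) b² + a²)` of the equation
of Wolff. -/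
def wolffV (p a b : ℝ) : ℝ :=
  ((2 * p - 3) * b ^ 2 + (p - 1) * a ^ 2) / ((p - 1) * b ^ 2 + a ^ 2)

/-- `w` solves `w'' + V(w, w') w = 0` on the real line, with initial data
`(w(0), w'(0)) ≠ (0, 0)`. -/
def IsWolffProfile (p : ℝ) (w : ℝ → ℝ) : Prop :=
  ContDiff ℝ 2 w ∧ (w 0, deriv w 0) ≠ (0, 0) ∧
    ∀ s : ℝ, deriv (deriv w) s + wolffV p (w s) (deriv w s) * w s = 0

/-- The Wolff solution `x ↦ e^{τ (ρ · x - t)} w(τ ρ^⊥ · x)`. -/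
def wolffSolution {d : ℕ} (w : ℝ → ℝ) (t : ℝ) (ρ ρ' : E d) (τ : ℝ) (x : E d) : ℝ :=
  Real.exp (τ * (inner ℝ ρ x - t)) * w (τ * inner ℝ ρ' x)

/-- The indicator function
`I(t, ρ, ρ^⊥, τ) = τ^{d-p} ⟨(Λ_σ - Λ_1) f, f⟩`, with `f` the boundary values of the Wolff
solution. -/
def indicatorFun {d : ℕ} (Ω : Set (E d)) (p : ℝ) [Fact (1 < p)] (σ : E d → ℝ) (w : ℝ → ℝ)
    (t : ℝ) (ρ ρ' : E d) (τ : ℝ) : ℝ :=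
  τ ^ ((d : ℝ) - p) *
    (dnMap Ω p σ (boundaryValueOfFun Ω p (wolffSolution w t ρ ρ' τ)) -
      dnMap Ω p (fun _ => 1) (boundaryValueOfFun Ω p (wolffSolution w t ρ ρ' τ)))
      (boundaryValueOfFun Ω p (wolffSolution w t ρ ρ' τ))

/-- `D` has Lipschitz boundary: near each boundary point, and after a rotation which takes some
unit vector `e` to the vertical direction, `D` is the part of space above the graph of a
Lipschitz function `g` of the horizontal variable `x - (e · x) e`. -/
def HasLipschitzBoundary {d : ℕ} (D : Set (E d)) : Prop :=
  ∀ x₀ ∈ frontier D, ∃ (e : E d) (K : NNReal) (g : E d → ℝ), ‖e‖ = 1 ∧ LipschitzWith K g ∧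
    ∀ᶠ x in 𝓝 x₀, x ∈ D ↔ g (x - inner ℝ e x • e) < inner ℝ e x

/-- `σ` is equal to one in `Ω \ D`, and inside the inclusion `D` it is either bounded
between two constants in `]0,1[`, or bounded between two constants in `]1,∞[`. -/
def IsFiniteInclusion {d : ℕ} (Ω D : Set (E d)) (σ : E d → ℝ) : Prop :=
  (∀ x ∈ Ω \ D, σ x = 1) ∧
    ((∃ a b : ℝ, 0 < a ∧ b < 1 ∧ ∀ x ∈ D, a < σ x ∧ σ x < b) ∨
      (∃ a b : ℝ, 1 < a ∧ ∀ x ∈ D, a < σ x ∧ σ x < b))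

/-- The support function `sup_{x ∈ D} x · ρ`. -/
def supportFun {d : ℕ} (D : Set (E d)) (ρ : E d) : ℝ :=
  sSup ((fun x => inner ℝ ρ x) '' D)

end

end Enclosure

/-!
A Wolff solution `u` with parameters `t, ρ, ρ^⊥, τ` is `p`-harmonic, and
`|∇u|^p = τ^p e^{pτ (ρ · x - t)} (w² + w'²)^{p/2}`. The last factor stays between positive
constants, because `log (w² + w'²) + (2-p)/(p-1) · w'² / (w² + w'²)` is a first integral of the
equation of `w`.

Let `v` minimize the `σ`-energy with the boundary values `f` of `u`. Comparing the `σ`-energies of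
`v` and `u` bounds `⟨(Λ_σ - Λ_1) f, f⟩` from above by `∫ (σ - 1) |∇u|^p`. Applying Young's
inequality with weight `σ` to `∫ |∇u|^{p-2} ∇u · ∇v = ∫ |∇u|^p`, which holds since `u` is
`p`-harmonic, bounds it from below by `(p-1) ∫ (1 - σ^{-1/(p-1)}) |∇u|^p`. Both integrands vanish
outside `D` and have the same constant sign in `D`, so the indicator function is comparable to
`τ^d ∫_D e^{pτ (ρ · x - t)} dx`.

If `t ≠ h_D(ρ)`, this mass decays or grows exponentially in `τ`. If `t = h_D(ρ)`, then `D` contains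
a ball of radius comparable to `1/τ` at distance less than `1/τ` from a point of the supporting
hyperplane, so that the mass is at least a multiple of `τ^{-d}`. The threshold `t = h_D(ρ)` yields
the support function of `D`, hence the open convex set `conv D`.
-/

namespace Enclosure

/-! ### Solutions of the equation of Wolff -/

theorem pos_of_abs_deriv_le_mul {f f' : ℝ → ℝ} {C : ℝ} (hf : ∀ s, HasDerivAt f (f' s) s)
    (hC : ∀ s, |f' s| ≤ C * f s) (h0 : 0 < f 0) (s : ℝ) : 0 < f s := by
  have hexp (c s : ℝ) : HasDerivAt (fun s => f s * Real.exp (c * s))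
      ((f' s + c * f s) * Real.exp (c * s)) s :=
    ((hf s).mul (((hasDerivAt_id s).const_mul c).exp)).congr_deriv (by simp only [id]; ring)
  have pos_of_le {c : ℝ} (h : f 0 * Real.exp (c * 0) ≤ f s * Real.exp (c * s)) : 0 < f s := by
    rw [mul_zero, Real.exp_zero, mul_one] at h
    exact pos_of_mul_pos_left (h0.trans_le h) (Real.exp_pos _).le
  rcases le_total 0 s with hs | hs
  · refine pos_of_le (monotone_of_hasDerivAt_nonneg (hexp C) (fun s => ?_) hs)
    exact mul_nonneg (by linarith [neg_le_of_abs_le (hC s)]) (Real.exp_pos _).le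
  · refine pos_of_le (antitone_of_hasDerivAt_nonpos (hexp (-C)) (fun s => ?_) hs)
    exact mul_nonpos_of_nonpos_of_nonneg (by linarith [le_of_abs_le (hC s)]) (Real.exp_pos _).le

section Profile

variable {p : ℝ} {w : ℝ → ℝ}

theorem eq_zero_of_wolffDenom_eq_zero (hp : 1 < p) {a b : ℝ} (h : (p - 1) * b ^ 2 + a ^ 2 = 0) :
    a = 0 := by
  have := mul_nonneg (sub_nonneg.2 hp.le) (sq_nonneg b)
  nlinarith [sq_nonneg a]

/-- The rate `ab / ((p-1) b² + a²)` which governs the motion of a Wolff profile in the phase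
plane: both `log (w² + w'²)` and `w'² / (w² + w'²)` have a constant multiple of it as derivative. -/
noncomputable def wolffRate (p a b : ℝ) : ℝ := a * b / ((p - 1) * b ^ 2 + a ^ 2)

theorem wolffRate_mul_denom (hp : 1 < p) (a b : ℝ) :
    wolffRate p a b * ((p - 1) * b ^ 2 + a ^ 2) = a * b := by
  refine div_mul_cancel_of_imp fun h => ?_
  rw [eq_zero_of_wolffDenom_eq_zero hp h, zero_mul]

theorem wolffV_mul (hp : 1 < p) (a b : ℝ) :
    wolffV p a b * a = (p - 1) * a - (p - 2) ^ 2 * b * wolffRate p a b := by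
  rcases eq_or_ne ((p - 1) * b ^ 2 + a ^ 2) 0 with hN | hN
  · simp [wolffRate, eq_zero_of_wolffDenom_eq_zero hp hN]
  · rw [wolffV, div_mul_eq_mul_div, div_eq_iff hN]
    linear_combination (p - 2) ^ 2 * b * wolffRate_mul_denom hp a b

theorem abs_wolffRate_le (hp : 1 < p) (a b : ℝ) : |wolffRate p a b| ≤ 1 / (2 * √(p - 1)) := by
  have : 0 < √(p - 1) := Real.sqrt_pos.2 (by linarith)
  have hsq : √(p - 1) ^ 2 = p - 1 := Real.sq_sqrt (by linarith)
  have hN : 0 ≤ (p - 1) * b ^ 2 + a ^ 2 := by rw [← hsq]; positivity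
  have amgm : 2 * √(p - 1) * |a * b| ≤ (p - 1) * b ^ 2 + a ^ 2 := by
    rw [abs_mul, ← sq_abs a, ← sq_abs b]
    linear_combination sq_nonneg (√(p - 1) * |b| - |a|) + |b| ^ 2 * hsq
  rw [wolffRate, abs_div, abs_of_nonneg hN]
  refine div_le_of_le_mul₀ hN (by positivity) ?_
  rwa [one_div_mul_eq_div, le_div_iff₀' (by positivity)]

/-- The squared distance `w² + w'²` to the origin of the phase plane. -/
noncomputable def radiusSq (w : ℝ → ℝ) (s : ℝ) : ℝ := w s ^ 2 + deriv w s ^ 2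

theorem radiusSq_nonneg (w : ℝ → ℝ) (s : ℝ) : 0 ≤ radiusSq w s := by
  unfold radiusSq; positivity

/-- The quantity `log (w² + w'²) + (2-p)/(p-1) · w'² / (w² + w'²)`, which is constant along Wolff
profiles. -/
noncomputable def firstIntegral (p : ℝ) (w : ℝ → ℝ) (s : ℝ) : ℝ :=
  Real.log (radiusSq w s) + (2 - p) / (p - 1) * (deriv w s ^ 2 / radiusSq w s)

namespace IsWolffProfile

theorem hasDerivAt (hw : IsWolffProfile p w) (s : ℝ) : HasDerivAt w (deriv w s) s :=
  (hw.1.differentiable (by norm_num) s).hasDerivAt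

theorem contDiff_deriv (hw : IsWolffProfile p w) : ContDiff ℝ 1 (deriv w) :=
  have h : ContDiff ℝ (1 + 1) w := by simpa [one_add_one_eq_two] using hw.1
  (contDiff_succ_iff_deriv.1 h).2.2

theorem contDiff_radiusSq (hw : IsWolffProfile p w) : ContDiff ℝ 1 (radiusSq w) :=
  ((hw.1.of_le (by norm_num)).pow 2).add (hw.contDiff_deriv.pow 2)

theorem hasDerivAt_deriv (hw : IsWolffProfile p w) (s : ℝ) :
    HasDerivAt (deriv w) (-(wolffV p (w s) (deriv w s) * w s)) s := by
  have h := (hw.contDiff_deriv.differentiable (by norm_num) s).hasDerivAt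
  rwa [eq_neg_of_add_eq_zero_left (hw.2.2 s)] at h

theorem hasDerivAt_radiusSq (hp : 1 < p) (hw : IsWolffProfile p w) (s : ℝ) :
    HasDerivAt (radiusSq w) (2 * (2 - p) * wolffRate p (w s) (deriv w s) * radiusSq w s) s := by
  refine (((hw.hasDerivAt s).pow 2).add ((hw.hasDerivAt_deriv s).pow 2)).congr_deriv ?_
  simp only [Nat.cast_ofNat, radiusSq]
  linear_combination -2 * deriv w s * wolffV_mul hp (w s) (deriv w s)
    - 2 * (2 - p) * wolffRate_mul_denom hp (w s) (deriv w s)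

theorem radiusSq_pos (hp : 1 < p) (hw : IsWolffProfile p w) (s : ℝ) : 0 < radiusSq w s := by
  refine pos_of_abs_deriv_le_mul (C := |2 * (2 - p)| * (1 / (2 * √(p - 1))))
    (hw.hasDerivAt_radiusSq hp) (fun s => ?_) ?_ s
  · rw [abs_mul, abs_mul, abs_of_nonneg (radiusSq_nonneg w s)]
    have := abs_wolffRate_le hp (w s) (deriv w s)
    gcongr
    exact radiusSq_nonneg w s
  · refine (radiusSq_nonneg w 0).lt_of_ne fun h => hw.2.1 (Prod.ext ?_ ?_) <;>
    · unfold radiusSq at h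
      nlinarith [sq_nonneg (w 0), sq_nonneg (deriv w 0)]

theorem hasDerivAt_log_radiusSq (hp : 1 < p) (hw : IsWolffProfile p w) (s : ℝ) :
    HasDerivAt (fun s => Real.log (radiusSq w s))
      (2 * (2 - p) * wolffRate p (w s) (deriv w s)) s := by
  have hR := (hw.radiusSq_pos hp s).ne'
  refine ((hw.hasDerivAt_radiusSq hp s).log hR).congr_deriv (mul_div_cancel_right₀ _ hR)

theorem hasDerivAt_sq_div_radiusSq (hp : 1 < p) (hw : IsWolffProfile p w) (s : ℝ) :
    HasDerivAt (fun s => deriv w s ^ 2 / radiusSq w s)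
      (-(2 * (p - 1) * wolffRate p (w s) (deriv w s))) s := by
  have hR := hw.radiusSq_pos hp s
  refine (((hw.hasDerivAt_deriv s).pow 2).div (hw.hasDerivAt_radiusSq hp s) hR.ne').congr_deriv ?_
  rw [div_eq_iff (by positivity)]
  simp only [Pi.pow_apply, Nat.cast_ofNat, radiusSq]
  linear_combination
    -2 * deriv w s * (w s ^ 2 + deriv w s ^ 2) * wolffV_mul hp (w s) (deriv w s)
      + 2 * (p - 1) * (w s ^ 2 + deriv w s ^ 2) * wolffRate_mul_denom hp (w s) (deriv w s)

theorem hasDerivAt_firstIntegral (hp : 1 < p) (hw : IsWolffProfile p w) (s : ℝ) :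
    HasDerivAt (firstIntegral p w) 0 s := by
  refine ((hw.hasDerivAt_log_radiusSq hp s).add
    ((hw.hasDerivAt_sq_div_radiusSq hp s).const_mul ((2 - p) / (p - 1)))).congr_deriv ?_
  have hp' : p - 1 ≠ 0 := by linarith
  field_simp
  ring

theorem exists_radiusSq_bounds (hp : 1 < p) (hw : IsWolffProfile p w) :
    ∃ m M : ℝ, 0 < m ∧ ∀ s, m ≤ radiusSq w s ∧ radiusSq w s ≤ M := by
  set κ := (2 - p) / (p - 1)
  have hconst (s : ℝ) : firstIntegral p w s = firstIntegral p w 0 :=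
    is_const_of_deriv_eq_zero (fun s => (hw.hasDerivAt_firstIntegral hp s).differentiableAt)
      (fun s => (hw.hasDerivAt_firstIntegral hp s).deriv) s 0
  have hlog (s : ℝ) : |Real.log (radiusSq w s) - firstIntegral p w 0| ≤ |κ| := by
    have hR := hw.radiusSq_pos hp s
    rw [← hconst s, firstIntegral, sub_add_cancel_left, abs_neg, abs_mul]
    refine mul_le_of_le_one_right (abs_nonneg _) ?_
    rw [abs_of_nonneg (by positivity), div_le_one hR, radiusSq]
    exact le_add_of_nonneg_left (sq_nonneg _)
  refine ⟨Real.exp (firstIntegral p w 0 - |κ|), Real.exp (firstIntegral p w 0 + |κ|),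
    Real.exp_pos _, fun s => ?_⟩
  have hR := hw.radiusSq_pos hp s
  have := abs_le.1 (hlog s)
  rw [← Real.le_log_iff_exp_le hR, ← Real.log_le_iff_le_exp hR]
  constructor <;> linarith

theorem contDiff_radiusSq_rpow (hp : 1 < p) (hw : IsWolffProfile p w) (q : ℝ) :
    ContDiff ℝ 1 fun s => radiusSq w s ^ q :=
  hw.contDiff_radiusSq.rpow_const_of_ne fun s => (hw.radiusSq_pos hp s).ne'

/-- Divergence form of the equation of Wolff: this identity makes the Wolff solutions
`p`-harmonic. -/
theorem hasDerivAt_rpow_mul_deriv (hp : 1 < p) (hw : IsWolffProfile p w) (s : ℝ) :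
    HasDerivAt (fun s => radiusSq w s ^ ((p - 2) / 2) * deriv w s)
      (-((p - 1) * (radiusSq w s ^ ((p - 2) / 2) * w s))) s := by
  have hR := hw.radiusSq_pos hp s
  refine (((hw.hasDerivAt_radiusSq hp s).rpow_const (p := (p - 2) / 2) (Or.inl hR.ne')).mul
    (hw.hasDerivAt_deriv s)).congr_deriv ?_
  rw [Real.rpow_sub_one hR.ne']
  field_simp
  linear_combination -wolffV_mul hp (w s) (deriv w s)

end IsWolffProfile

end Profile

/-! ### Interior corkscrews of Lipschitz domains -/

section Corkscrew

/-- At every scale `0 < s < r` the set `D` contains, within distance `s` of `x`, a ball of radius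
`κ s`. -/
def HasCorkscrewAt {X : Type*} [PseudoMetricSpace X] (D : Set X) (r κ : ℝ) (x : X) : Prop :=
  ∀ s, 0 < s → s < r → ∃ y, Metric.ball y (κ * s) ⊆ D ∩ Metric.ball x s

/-- The interior corkscrew condition: `D` has corkscrews at all its boundary points, with uniform
constants. It holds for bounded Lipschitz domains, and is all that the lower bound on the indicator
function needs of the boundary. -/
def HasInteriorCorkscrews {X : Type*} [PseudoMetricSpace X] (D : Set X) : Prop :=
  ∃ r κ : ℝ, 0 < r ∧ 0 < κ ∧ ∀ x ∈ frontier D, HasCorkscrewAt D r κ x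

theorem HasCorkscrewAt.mono {X : Type*} [PseudoMetricSpace X] {D : Set X} {r r' κ κ' : ℝ} {x : X}
    (h : HasCorkscrewAt D r κ x) (hr : r' ≤ r) (hκ : κ' ≤ κ) : HasCorkscrewAt D r' κ' x := by
  intro s hs hsr
  obtain ⟨y, hy⟩ := h s hs (hsr.trans_le hr)
  exact ⟨y, (Metric.ball_subset_ball (mul_le_mul_of_nonneg_right hκ hs.le)).trans hy⟩

theorem lipschitz_lt_of_mem_cone {V : Type*} [NormedAddCommGroup V] [InnerProductSpace ℝ V]
    {e x v : V} {K : NNReal} {g : V → ℝ} {s : ℝ} (he : ‖e‖ = 1) (hg : LipschitzWith K g)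
    (hx : g (x - inner ℝ e x • e) ≤ inner ℝ e x) (hv : (2 * K + 1) * ‖v‖ < s) :
    g (x + s • e + v - inner ℝ e (x + s • e + v) • e) < inner ℝ e (x + s • e + v) := by
  have hev : |inner ℝ e v| ≤ ‖v‖ := by simpa [he] using abs_real_inner_le_norm e v
  have hin : inner ℝ e (x + s • e + v) = inner ℝ e x + s + inner ℝ e v := by
    simp [inner_add_right, inner_smul_right, he]
  have hshift : x + s • e + v - inner ℝ e (x + s • e + v) • e =
      (x - inner ℝ e x • e) + (v - inner ℝ e v • e) := by
    rw [hin]; module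
  have hdist : g (x + s • e + v - inner ℝ e (x + s • e + v) • e) ≤
      g (x - inner ℝ e x • e) + K * (2 * ‖v‖) := by
    rw [hshift]
    refine sub_le_iff_le_add'.1 ((le_abs_self _).trans ((hg.dist_le_mul _ _).trans ?_))
    rw [dist_self_add_left]
    gcongr
    calc ‖v - inner ℝ e v • e‖ ≤ ‖v‖ + ‖inner ℝ e v • e‖ := norm_sub_le _ _
      _ ≤ 2 * ‖v‖ := by rw [norm_smul, he, mul_one, Real.norm_eq_abs]; linarith
  rw [hin] at hdist ⊢
  linarith [neg_le_of_abs_le hev]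

variable {d : ℕ} {D : Set (E d)}

theorem HasLipschitzBoundary.exists_eventually_hasCorkscrewAt (hD : HasLipschitzBoundary D)
    {x₀ : E d} (hx₀ : x₀ ∈ frontier D) :
    ∃ r κ : ℝ, 0 < r ∧ 0 < κ ∧ ∀ᶠ x in 𝓝 x₀, x ∈ frontier D → HasCorkscrewAt D r κ x := by
  obtain ⟨e, K, g, he, hg, hev⟩ := hD x₀ hx₀
  obtain ⟨δ, hδ, hgraph⟩ := Metric.eventually_nhds_iff_ball.1 hev
  refine ⟨δ / 2, 1 / (2 * (2 * K + 1)), by positivity, by positivity, ?_⟩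
  filter_upwards [Metric.ball_mem_nhds x₀ (half_pos hδ)] with x hx hxD s hs hsr
  have hxg : g (x - inner ℝ e x • e) ≤ inner ℝ e x := by
    have hcl : IsClosed {x : E d | g (x - inner ℝ e x • e) ≤ inner ℝ e x} :=
      isClosed_le (hg.continuous.comp (by fun_prop)) (by fun_prop)
    have hxcl : x ∈ closure (Metric.ball x₀ δ ∩ D) := Metric.isOpen_ball.inter_closure
      ⟨Metric.ball_subset_ball (by linarith) hx, frontier_subset_closure hxD⟩
    exact closure_minimal (fun z hz => ((hgraph z hz.1).1 hz.2).le) hcl hxcl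
  refine ⟨x + (s / 2) • e, fun y hy => ?_⟩
  obtain ⟨v, rfl⟩ : ∃ v, y = x + (s / 2) • e + v := ⟨y - (x + (s / 2) • e), by abel⟩
  have hv : (2 * K + 1) * ‖v‖ < s / 2 := by
    rw [Metric.mem_ball, dist_self_add_left, one_div_mul_eq_div, lt_div_iff₀' (by positivity)] at hy
    linarith
  have hvs : ‖v‖ < s / 2 :=
    (le_mul_of_one_le_left (norm_nonneg v) (by linarith [K.coe_nonneg])).trans_lt hv
  have hyx : x + (s / 2) • e + v ∈ Metric.ball x s := by
    rw [Metric.mem_ball, dist_eq_norm, add_assoc, add_sub_cancel_left]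
    calc ‖(s / 2) • e + v‖ ≤ ‖(s / 2) • e‖ + ‖v‖ := norm_add_le _ _
      _ < s := by rw [norm_smul, he, mul_one, Real.norm_of_nonneg (by positivity)]; linarith
  have hyx₀ : x + (s / 2) • e + v ∈ Metric.ball x₀ δ := by
    rw [Metric.mem_ball] at hx hyx ⊢
    linarith [dist_triangle (x + (s / 2) • e + v) x x₀]
  exact ⟨(hgraph _ hyx₀).2 (lipschitz_lt_of_mem_cone he hg hxg hv), hyx⟩

theorem HasLipschitzBoundary.hasInteriorCorkscrews (hD : HasLipschitzBoundary D)
    (hDb : Bornology.IsBounded D) : HasInteriorCorkscrews D := by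
  have hcompact : IsCompact (frontier D) :=
    Metric.isCompact_of_isClosed_isBounded isClosed_frontier
      (hDb.closure.subset frontier_subset_closure)
  refine hcompact.induction_on
    (p := fun S => ∃ r κ : ℝ, 0 < r ∧ 0 < κ ∧ ∀ x ∈ S, HasCorkscrewAt D r κ x) ?_ ?_ ?_ ?_
  · exact ⟨1, 1, by simp⟩
  · rintro S T hST ⟨r, κ, hr, hκ, h⟩
    exact ⟨r, κ, hr, hκ, fun x hx => h x (hST hx)⟩
  · rintro S T ⟨r, κ, hr, hκ, h⟩ ⟨r', κ', hr', hκ', h'⟩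
    refine ⟨min r r', min κ κ', lt_min hr hr', lt_min hκ hκ', ?_⟩
    rintro x (hx | hx)
    · exact (h x hx).mono (min_le_left _ _) (min_le_left _ _)
    · exact (h' x hx).mono (min_le_right _ _) (min_le_right _ _)
  · intro x₀ hx₀
    obtain ⟨r, κ, hr, hκ, h⟩ := hD.exists_eventually_hasCorkscrewAt hx₀
    exact ⟨{x | x ∈ frontier D → HasCorkscrewAt D r κ x} ∩ frontier D,
      inter_mem (mem_nhdsWithin_of_mem_nhds h) self_mem_nhdsWithin,
      r, κ, hr, hκ, fun x hx => hx.1 hx.2⟩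

end Corkscrew

/-! ### The support function and the convex hull -/

section SupportFunction

theorem exists_unit_orthogonal {V : Type*} [NormedAddCommGroup V] [InnerProductSpace ℝ V]
    (hV : 2 ≤ Module.finrank ℝ V) (u : V) : ∃ v : V, ‖v‖ = 1 ∧ inner ℝ u v = 0 := by
  have : FiniteDimensional ℝ V := .of_finrank_pos (by omega)
  have hne : (Submodule.span ℝ {u})ᗮ ≠ ⊥ := fun h => by
    have hsum := (Submodule.span ℝ {u}).finrank_add_finrank_orthogonal
    have hspan : Module.finrank ℝ (Submodule.span ℝ {u}) ≤ 1 := by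
      simpa using finrank_span_le_card (R := ℝ) {u}
    rw [h, finrank_bot] at hsum
    omega
  obtain ⟨v, hv, hv0⟩ := Submodule.exists_mem_ne_zero_of_ne_bot hne
  refine ⟨‖v‖⁻¹ • v, norm_smul_inv_norm hv0, ?_⟩
  rw [inner_smul_right, Submodule.mem_orthogonal_singleton_iff_inner_right.1 hv, mul_zero]

variable {d : ℕ} {D : Set (E d)}

theorem bddAbove_inner_image (hDb : Bornology.IsBounded D) (ρ : E d) :
    BddAbove ((fun x => inner ℝ ρ x) '' D) := by
  have hcont : Continuous fun x : E d => inner ℝ ρ x := by fun_prop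
  exact (hDb.isCompact_closure.bddAbove_image hcont.continuousOn).mono
    (Set.image_mono subset_closure)

theorem inner_le_supportFun (hDb : Bornology.IsBounded D) (ρ : E d) {x : E d} (hx : x ∈ D) :
    inner ℝ ρ x ≤ supportFun D ρ :=
  le_csSup (bddAbove_inner_image hDb ρ) ⟨x, hx, rfl⟩

theorem supportFun_le (hDne : D.Nonempty) {ρ : E d} {t : ℝ} (h : ∀ x ∈ D, inner ℝ ρ x ≤ t) :
    supportFun D ρ ≤ t :=
  csSup_le (hDne.image _) (Set.forall_mem_image.2 h)

theorem exists_lt_inner_of_lt_supportFun (hDne : D.Nonempty) {ρ : E d} {t : ℝ}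
    (ht : t < supportFun D ρ) : ∃ x ∈ D, t < inner ℝ ρ x :=
  Set.exists_mem_image.1 (exists_lt_of_lt_csSup (hDne.image _) ht)

theorem supportFun_smul {c : ℝ} (hc : 0 ≤ c) (D : Set (E d)) (ρ : E d) :
    supportFun D (c • ρ) = c * supportFun D ρ := by
  rw [supportFun, supportFun, ← smul_eq_mul, ← Real.sSup_smul_of_nonneg hc, ← Set.image_smul,
    Set.image_image]
  simp only [real_inner_smul_left, smul_eq_mul]

theorem exists_mem_frontier_inner_eq_supportFun (hDne : D.Nonempty) (hDb : Bornology.IsBounded D)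
    {ρ : E d} (hρ : ρ ≠ 0) : ∃ x ∈ frontier D, inner ℝ ρ x = supportFun D ρ := by
  have hcont : Continuous fun x : E d => inner ℝ ρ x := by fun_prop
  obtain ⟨x, hx, hmax⟩ := hDb.isCompact_closure.exists_isMaxOn hDne.closure hcont.continuousOn
  have hle : inner ℝ ρ x ≤ supportFun D ρ :=
    closure_minimal (fun y hy => inner_le_supportFun hDb ρ hy)
      (isClosed_le hcont continuous_const) hx
  have hge : supportFun D ρ ≤ inner ℝ ρ x := supportFun_le hDne fun y hy => hmax (subset_closure hy)
  refine ⟨x, ⟨hx, fun hxD => ?_⟩, hle.antisymm hge⟩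
  have hray : Tendsto (fun ε : ℝ => x + ε • ρ) (𝓝[>] 0) (𝓝 x) := by
    refine tendsto_nhdsWithin_of_tendsto_nhds (Continuous.tendsto' (by fun_prop) _ _ ?_)
    rw [zero_smul, add_zero]
  obtain ⟨ε, hεD, hε⟩ :=
    ((hray.eventually (mem_interior_iff_mem_nhds.1 hxD)).and self_mem_nhdsWithin).exists
  have hεx : inner ℝ ρ (x + ε • ρ) ≤ inner ℝ ρ x := hmax (subset_closure hεD)
  rw [inner_add_right, inner_smul_right] at hεx
  linarith [mul_pos hε (real_inner_self_pos.2 hρ)]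

theorem closure_convexHull_eq_halfSpaces (hDne : D.Nonempty) (hDb : Bornology.IsBounded D) :
    closure (convexHull ℝ D) = {x | ∀ ρ : E d, ‖ρ‖ = 1 → inner ℝ ρ x ≤ supportFun D ρ} := by
  refine Set.Subset.antisymm ?_ fun x hx => ?_
  · simp only [Set.ofPred_forall]
    refine closure_minimal (convexHull_min ?_ ?_) ?_
    · exact fun x hx => Set.mem_iInter₂.2 fun ρ _ => inner_le_supportFun hDb ρ hx
    · exact convex_iInter₂ fun ρ _ => convex_halfSpace_le (innerₛₗ ℝ ρ).isLinear _
    · exact isClosed_biInter fun ρ _ => isClosed_le (by fun_prop) continuous_const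
  · by_contra hxc
    obtain ⟨f, u, hfu, hux⟩ := geometric_hahn_banach_closed_point
      (convex_convexHull ℝ D).closure isClosed_closure hxc
    obtain ⟨v, rfl⟩ := (InnerProductSpace.toDual ℝ (E d)).surjective f
    simp only [InnerProductSpace.toDual_apply_apply] at hfu hux
    have hDu (y : E d) (hy : y ∈ D) : inner ℝ v y < u :=
      hfu y (subset_closure (subset_convexHull ℝ D hy))
    have hv : v ≠ 0 := by
      rintro rfl
      obtain ⟨y, hy⟩ := hDne
      have := hDu y hy
      simp only [inner_zero_left] at this hux
      exact this.not_gt hux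
    have hle := hx (‖v‖⁻¹ • v) (norm_smul_inv_norm hv)
    rw [real_inner_smul_left, supportFun_smul (by positivity),
      mul_le_mul_iff_right₀ (by positivity)] at hle
    exact (hle.trans (supportFun_le hDne fun y hy => (hDu y hy).le)).not_gt hux

theorem convexHull_eq_interior_halfSpaces (hD : IsOpen D) (hDne : D.Nonempty)
    (hDb : Bornology.IsBounded D) :
    convexHull ℝ D = interior {x | ∀ ρ : E d, ‖ρ‖ = 1 → inner ℝ ρ x ≤ supportFun D ρ} := by
  have hopen : IsOpen (convexHull ℝ D) := hD.convexHull
  rw [← closure_convexHull_eq_halfSpaces hDne hDb,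
    (convex_convexHull ℝ D).interior_closure_eq_interior_of_nonempty_interior
      (hopen.interior_eq.symm ▸ hDne.convexHull), hopen.interior_eq]

end SupportFunction

/-! ### Exponential weights -/

section ExpWeight

variable {d : ℕ} {D : Set (E d)} {ρ : E d} {k t : ℝ}

/-- The mass `∫_D e^{k (ρ · x - t)} dx` of an exponential weight. With `k = p τ` it is comparable to
the energy in `D` of the Wolff solution with parameters `t`, `ρ`, `τ`, up to the factor `τ^p`. -/
noncomputable def expMass (D : Set (E d)) (ρ : E d) (k t : ℝ) : ℝ :=
  ∫ x in D, Real.exp (k * (inner ℝ ρ x - t))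

theorem expMass_nonneg (D : Set (E d)) (ρ : E d) (k t : ℝ) : 0 ≤ expMass D ρ k t :=
  integral_nonneg fun _ => (Real.exp_pos _).le

theorem integrableOn_expWeight (hDb : Bornology.IsBounded D) (ρ : E d) (k t : ℝ) :
    IntegrableOn (fun x : E d => Real.exp (k * (inner ℝ ρ x - t))) D := by
  have hcont : Continuous fun x : E d => Real.exp (k * (inner ℝ ρ x - t)) := by fun_prop
  exact (hcont.continuousOn.integrableOn_compact hDb.isCompact_closure).mono_set subset_closure

theorem expMass_le (hDb : Bornology.IsBounded D) (ρ : E d) (hk : 0 ≤ k) (t : ℝ) :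
    expMass D ρ k t ≤ Real.exp (k * (supportFun D ρ - t)) * volume.real D := by
  refine (Real.le_norm_self _).trans
    (norm_setIntegral_le_of_norm_le_const hDb.measure_lt_top fun x hx => ?_)
  rw [Real.norm_of_nonneg (Real.exp_pos _).le]
  gcongr
  exact inner_le_supportFun hDb ρ hx

theorem le_expMass_of_ball_subset (hDb : Bornology.IsBounded D) (hk : 0 ≤ k) {y : E d} {r l : ℝ}
    (hyD : Metric.ball y r ⊆ D) (hl : ∀ x ∈ Metric.ball y r, l ≤ inner ℝ ρ x) :
    volume.real (Metric.ball y r) * Real.exp (k * (l - t)) ≤ expMass D ρ k t := by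
  have hint := integrableOn_expWeight hDb ρ k t
  calc volume.real (Metric.ball y r) * Real.exp (k * (l - t))
      = ∫ _ in Metric.ball y r, Real.exp (k * (l - t)) := by simp
    _ ≤ expMass (Metric.ball y r) ρ k t := by
        refine setIntegral_mono_on (integrableOn_const measure_ball_lt_top.ne)
          (hint.mono_set hyD) measurableSet_ball fun x hx => ?_
        gcongr
        exact hl x hx
    _ ≤ expMass D ρ k t :=
        setIntegral_mono_set hint (ae_of_all _ fun _ => (Real.exp_pos _).le) hyD.eventuallyLE

theorem volumeReal_ball_mul_inv (y : E d) (κ : ℝ) {τ : ℝ} (hτ : 0 < τ) :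
    τ ^ d * volume.real (Metric.ball y (κ * τ⁻¹)) = volume.real (Metric.ball (0 : E d) κ) := by
  rw [mul_comm κ, Measure.real, Measure.addHaar_ball_mul_of_pos _ _ (inv_pos.2 hτ),
    finrank_euclideanSpace_fin, ENNReal.toReal_mul, ENNReal.toReal_ofReal (by positivity),
    ← mul_assoc, ← mul_pow, mul_inv_cancel₀ hτ.ne', one_pow, one_mul, Measure.real]

theorem HasInteriorCorkscrews.exists_le_pow_mul_expMass (hcork : HasInteriorCorkscrews D)
    (hDne : D.Nonempty) (hDb : Bornology.IsBounded D) (hk : 0 ≤ k) :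
    ∃ c τ₀ : ℝ, 0 < c ∧ 0 < τ₀ ∧ ∀ ρ : E d, ‖ρ‖ = 1 → ∀ τ : ℝ, τ₀ ≤ τ →
      c ≤ τ ^ d * expMass D ρ (k * τ) (supportFun D ρ) := by
  obtain ⟨r, κ, hr, hκ, hcork⟩ := hcork
  have hvol : 0 < volume.real (Metric.ball (0 : E d) κ) :=
    ENNReal.toReal_pos (Metric.measure_ball_pos _ _ hκ).ne' measure_ball_lt_top.ne
  refine ⟨volume.real (Metric.ball (0 : E d) κ) * Real.exp (-k), 2 / r, by positivity,
    by positivity, fun ρ hρ τ hτ => ?_⟩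
  have hτ0 : 0 < τ := (by positivity : 0 < 2 / r).trans_le hτ
  have hτr : τ⁻¹ < r := by
    rw [div_le_iff₀ hr] at hτ
    rw [inv_lt_iff_one_lt_mul₀ hτ0]
    linarith
  obtain ⟨x, hx, hρx⟩ := exists_mem_frontier_inner_eq_supportFun hDne hDb
    (norm_ne_zero_iff.1 (hρ.trans_ne one_ne_zero))
  obtain ⟨y, hy⟩ := hcork x hx τ⁻¹ (inv_pos.2 hτ0) hτr
  have hlow (z : E d) (hz : z ∈ Metric.ball y (κ * τ⁻¹)) :
      supportFun D ρ - τ⁻¹ ≤ inner ℝ ρ z := by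
    have hzx : ‖z - x‖ < τ⁻¹ := by rw [← dist_eq_norm]; exact (hy hz).2
    have := abs_real_inner_le_norm ρ (z - x)
    rw [hρ, one_mul, inner_sub_right, hρx] at this
    linarith [neg_le_of_abs_le this]
  calc volume.real (Metric.ball (0 : E d) κ) * Real.exp (-k)
      = τ ^ d * (volume.real (Metric.ball y (κ * τ⁻¹)) *
          Real.exp (k * τ * (supportFun D ρ - τ⁻¹ - supportFun D ρ))) := by
        rw [← mul_assoc, volumeReal_ball_mul_inv y κ hτ0]
        congr 2
        field_simp
        ring
    _ ≤ τ ^ d * expMass D ρ (k * τ) (supportFun D ρ) :=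
        mul_le_mul_of_nonneg_left (le_expMass_of_ball_subset hDb (by positivity)
          (fun z hz => (hy hz).1) hlow) (by positivity)

theorem tendsto_pow_mul_expMass_nhds_zero (hDb : Bornology.IsBounded D) (hk : 0 < k)
    (ht : supportFun D ρ < t) :
    Tendsto (fun τ => τ ^ d * expMass D ρ (k * τ) t) atTop (𝓝 0) := by
  have hδ : 0 < k * (t - supportFun D ρ) := mul_pos hk (sub_pos.2 ht)
  have hdecay := (tendsto_rpow_mul_exp_neg_mul_atTop_nhds_zero d _ hδ).mul_const
    (volume.real D)
  rw [zero_mul] at hdecay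
  refine squeeze_zero' ?_ ?_ hdecay
  · filter_upwards [eventually_ge_atTop 0] with τ hτ
    exact mul_nonneg (pow_nonneg hτ d) (expMass_nonneg ..)
  · filter_upwards [eventually_ge_atTop 0] with τ hτ
    rw [Real.rpow_natCast, mul_assoc]
    refine mul_le_mul_of_nonneg_left ((expMass_le hDb ρ (by positivity) t).trans_eq ?_)
      (pow_nonneg hτ d)
    congr 2
    ring

theorem tendsto_pow_mul_expMass_atTop (hD : IsOpen D) (hDne : D.Nonempty)
    (hDb : Bornology.IsBounded D) (hk : 0 < k) (ht : t < supportFun D ρ) :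
    Tendsto (fun τ => τ ^ d * expMass D ρ (k * τ) t) atTop atTop := by
  obtain ⟨y, hyD, hy⟩ := exists_lt_inner_of_lt_supportFun hDne ht
  obtain ⟨l, htl, hly⟩ := exists_between hy
  obtain ⟨r, hr, hball⟩ := Metric.isOpen_iff.1
    (hD.inter (isOpen_lt continuous_const (by fun_prop) : IsOpen {x : E d | l < inner ℝ ρ x}))
    y ⟨hyD, hly⟩
  have hvol : 0 < volume.real (Metric.ball y r) :=
    ENNReal.toReal_pos (Metric.measure_ball_pos _ _ hr).ne' measure_ball_lt_top.ne
  have hexp : Tendsto (fun τ => volume.real (Metric.ball y r) * Real.exp (k * (l - t) * τ))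
      atTop atTop :=
    (Real.tendsto_exp_atTop.comp
      (tendsto_id.const_mul_atTop (mul_pos hk (sub_pos.2 htl)))).const_mul_atTop hvol
  refine tendsto_atTop_mono' _ ?_ hexp
  filter_upwards [eventually_ge_atTop 1] with τ hτ
  calc volume.real (Metric.ball y r) * Real.exp (k * (l - t) * τ)
      ≤ expMass D ρ (k * τ) t := by
        rw [mul_right_comm]
        exact le_expMass_of_ball_subset hDb (by positivity) (fun x hx => (hball hx).1)
          fun x hx => (hball hx).2.le
    _ ≤ τ ^ d * expMass D ρ (k * τ) t :=
        le_mul_of_one_le_left (expMass_nonneg ..) (one_le_pow₀ hτ)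

end ExpWeight

/-! ### Sobolev spaces -/

section LpFacts

variable {α F : Type*} {mα : MeasurableSpace α} {μ : Measure α} [NormedAddCommGroup F] {p : ℝ}

theorem integrable_norm_rpow_of_memLp (hp : 0 < p) {f : α → F} (hf : MemLp f (ENNReal.ofReal p) μ) :
    Integrable (fun x => ‖f x‖ ^ p) μ := by
  have := hf.integrable_norm_rpow (by simpa using hp) ENNReal.ofReal_ne_top
  rwa [ENNReal.toReal_ofReal hp.le] at this

theorem Lp_norm_rpow_eq_integral (hp : 0 < p) (f : Lp F (ENNReal.ofReal p) μ) :
    ‖f‖ ^ p = ∫ x, ‖f x‖ ^ p ∂μ := by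
  have h := (Lp.memLp f).eLpNorm_eq_integral_rpow_norm (by simpa using hp) ENNReal.ofReal_ne_top
  have hnn : 0 ≤ ∫ x, ‖f x‖ ^ p ∂μ := integral_nonneg fun x => by positivity
  rw [ENNReal.toReal_ofReal hp.le] at h
  rw [Lp.norm_def, h, ENNReal.toReal_ofReal (by positivity), ← Real.rpow_mul hnn,
    inv_mul_cancel₀ hp.ne', Real.rpow_one]

theorem exists_clm_apply_eq_integral_inner [InnerProductSpace ℝ F] [hp : Fact (1 < p)] {k : α → F}
    (hk : MemLp k (ENNReal.ofReal p.conjExponent) μ) :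
    ∃ L : Lp F (ENNReal.ofReal p) μ →L[ℝ] ℝ, ∀ f, L f = ∫ x, inner ℝ (f x) (k x) ∂μ := by
  have hpq := Real.HolderConjugate.conjExponent hp.out
  have := hpq.ennrealOfReal
  have : Fact (1 ≤ ENNReal.ofReal p.conjExponent) := ⟨ENNReal.one_le_ofReal.2 hpq.symm.lt.le⟩
  refine ⟨((innerSL ℝ (E := F)).lpPairing μ (ENNReal.ofReal p)
    (ENNReal.ofReal p.conjExponent)).flip hk.toLp, fun f => ?_⟩
  rw [ContinuousLinearMap.flip_apply, ContinuousLinearMap.lpPairing_eq_integral]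
  refine integral_congr_ae ?_
  filter_upwards [hk.coeFn_toLp] with x hx
  rw [hx, innerSL_apply_apply]

theorem memLp_restrict_of_continuous {X : Type*} [PseudoMetricSpace X] [ProperSpace X]
    [MeasurableSpace X] [BorelSpace X] {ν : Measure X} [IsFiniteMeasureOnCompacts ν] {s : Set X}
    [SecondCountableTopologyEither X F] (hs : Bornology.IsBounded s) {f : X → F}
    (hf : Continuous f) (q : ENNReal) : MemLp f q (ν.restrict s) := by
  have : IsFiniteMeasure (ν.restrict s) :=
    ⟨by rw [Measure.restrict_apply_univ]; exact hs.measure_lt_top⟩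
  obtain ⟨C, hC⟩ := hs.isCompact_closure.exists_bound_of_continuousOn hf.continuousOn
  have hbound : ∀ᵐ x ∂ν.restrict (closure s), ‖f x‖ ≤ C :=
    (ae_restrict_iff' isClosed_closure.measurableSet).2 (ae_of_all _ hC)
  exact (memLp_top_of_bound hf.aestronglyMeasurable C
    (ae_mono (Measure.restrict_mono subset_closure le_rfl) hbound)).mono_exponent le_top

end LpFacts

theorem young_rpow {p A B : ℝ} (hp : 1 < p) (hA : 0 ≤ A) (hB : 0 ≤ B) :
    p * (A ^ (p - 1) * B) ≤ (p - 1) * A ^ p + B ^ p := by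
  have hp1 : p - 1 ≠ 0 := by linarith
  have hpow : (A ^ (p - 1)) ^ p.conjExponent = A ^ p := by
    rw [← Real.rpow_mul hA, Real.conjExponent, mul_div_cancel₀ _ hp1]
  have h := Real.young_inequality_of_nonneg (Real.rpow_nonneg hA (p - 1)) hB
    (Real.HolderConjugate.conjExponent hp).symm
  rw [hpow] at h
  calc p * (A ^ (p - 1) * B) ≤ p * (A ^ p / p.conjExponent + B ^ p / p) := by gcongr
    _ = (p - 1) * A ^ p + B ^ p := by rw [Real.conjExponent]; field_simp

section PoincareTest

variable {V : Type*} [NormedAddCommGroup V] [InnerProductSpace ℝ V] {e : V} {φ : V → ℝ}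

/-- Young's inequality absorbs the left side of the one-dimensional Poincaré inequality. -/
theorem neg_inner_mul_fderiv_norm_rpow_le {p R : ℝ} (hp : 1 < p) (he : ‖e‖ = 1) (hR : 0 ≤ R)
    (hφ : Differentiable ℝ φ) {x : V} (hx : φ x ≠ 0 → |inner ℝ e x| ≤ R) :
    -(p * (inner ℝ e x * fderiv ℝ (fun y => ‖φ y‖ ^ p) x e)) ≤
      (p - 1) * ‖φ x‖ ^ p + (p * R) ^ p * ‖fderiv ℝ φ x‖ ^ p := by
  have hp1 : p - 1 ≠ 0 := by linarith
  have hderiv : ‖fderiv ℝ (fun y => ‖φ y‖ ^ p) x e‖ ≤ p * ‖φ x‖ ^ (p - 1) * ‖fderiv ℝ φ x‖ := by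
    refine ((fderiv ℝ (fun y => ‖φ y‖ ^ p) x).le_opNorm e).trans ?_
    rw [he, mul_one]
    exact norm_fderiv_norm_rpow_le hφ hp
  have hbound : |inner ℝ e x * fderiv ℝ (fun y => ‖φ y‖ ^ p) x e| ≤
      R * (p * ‖φ x‖ ^ (p - 1) * ‖fderiv ℝ φ x‖) := by
    rw [abs_mul]
    rcases eq_or_ne (φ x) 0 with h0 | h0
    · rw [h0, norm_zero, Real.zero_rpow hp1, mul_zero, zero_mul] at hderiv ⊢
      rw [norm_le_zero_iff.1 hderiv, abs_zero, mul_zero, mul_zero]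
    · exact mul_le_mul (hx h0) hderiv (abs_nonneg _) hR
  calc -(p * (inner ℝ e x * fderiv ℝ (fun y => ‖φ y‖ ^ p) x e))
      ≤ p * (R * (p * ‖φ x‖ ^ (p - 1) * ‖fderiv ℝ φ x‖)) := by
        rw [← mul_neg]
        exact mul_le_mul_of_nonneg_left ((neg_le_abs _).trans hbound) (by linarith)
    _ = p * (‖φ x‖ ^ (p - 1) * (p * R * ‖fderiv ℝ φ x‖)) := by ring
    _ ≤ (p - 1) * ‖φ x‖ ^ p + (p * R * ‖fderiv ℝ φ x‖) ^ p :=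
        young_rpow hp (norm_nonneg _) (by positivity)
    _ = _ := by rw [Real.mul_rpow (by positivity) (norm_nonneg _)]

variable [MeasurableSpace V] [BorelSpace V] {μ : Measure V}

theorem integrable_inner_mul_fderiv [IsFiniteMeasureOnCompacts μ] {g : V → ℝ}
    (hg : ContDiff ℝ 1 g) (hgs : HasCompactSupport g) :
    Integrable (fun x => inner ℝ e x * fderiv ℝ g x e) μ :=
  ((by fun_prop : Continuous fun x : V => inner ℝ e x).mul
    ((hg.continuous_fderiv one_ne_zero).clm_apply continuous_const)).integrable_of_hasCompactSupport
    (hgs.fderiv_apply (𝕜 := ℝ) e).mul_left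

variable [FiniteDimensional ℝ V] [μ.IsAddHaarMeasure]

theorem integral_inner_mul_fderiv_eq_neg_integral (he : ‖e‖ = 1) {g : V → ℝ}
    (hg : ContDiff ℝ 1 g) (hgs : HasCompactSupport g) :
    ∫ x, inner ℝ e x * fderiv ℝ g x e ∂μ = -∫ x, g x ∂μ := by
  have hlin (x : V) : HasFDerivAt (fun y : V => inner ℝ e y) (innerSL ℝ e) x :=
    (innerSL ℝ e).hasFDerivAt
  have hlin_e (x : V) : fderiv ℝ (fun y : V => inner ℝ e y) x e = 1 := by
    rw [(hlin x).fderiv, innerSL_apply_apply, real_inner_self_eq_norm_sq, he, one_pow]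
  have hg_int : Integrable g μ := hg.continuous.integrable_of_hasCompactSupport hgs
  have h := integral_mul_fderiv_eq_neg_fderiv_mul_of_integrable (μ := μ) (v := e)
    (f := fun x : V => inner ℝ e x) (g := g) (by simpa only [hlin_e, one_mul] using hg_int)
    (integrable_inner_mul_fderiv hg hgs)
    (((by fun_prop : Continuous fun x : V => inner ℝ e x).mul
      hg.continuous).integrable_of_hasCompactSupport hgs.mul_left)
    (fun x _ => (hlin x).differentiableAt) (fun x _ => hg.differentiable one_ne_zero x)
  simpa only [hlin_e, one_mul] using h

theorem integral_norm_rpow_le_integral_norm_fderiv_rpow {p R : ℝ} (hp : 1 < p) (he : ‖e‖ = 1)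
    (hR : 0 ≤ R) (hφ : ContDiff ℝ 1 φ) (hφs : HasCompactSupport φ)
    (hslab : ∀ x, φ x ≠ 0 → |inner ℝ e x| ≤ R) :
    ∫ x, ‖φ x‖ ^ p ∂μ ≤ (p * R) ^ p * ∫ x, ‖fderiv ℝ φ x‖ ^ p ∂μ := by
  have hp0 : 0 < p := one_pos.trans hp
  have hg : ContDiff ℝ 1 fun x => ‖φ x‖ ^ p := hφ.norm_rpow hp
  have hgs : HasCompactSupport fun x => ‖φ x‖ ^ p :=
    hφs.comp_left (g := fun y : ℝ => ‖y‖ ^ p) (by simp [hp0.ne'])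
  have hg_int : Integrable (fun x => ‖φ x‖ ^ p) μ :=
    hg.continuous.integrable_of_hasCompactSupport hgs
  have hdφ_int : Integrable (fun x => ‖fderiv ℝ φ x‖ ^ p) μ :=
    ((hφ.continuous_fderiv one_ne_zero).norm.rpow_const
      fun _ => Or.inr hp0.le).integrable_of_hasCompactSupport
      ((hφs.fderiv (𝕜 := ℝ)).comp_left (g := fun y => ‖y‖ ^ p) (by simp [hp0.ne']))
  have hmono := integral_mono
    ((integrable_inner_mul_fderiv (μ := μ) (e := e) hg hgs).const_mul p).neg
    ((hg_int.const_mul (p - 1)).add (hdφ_int.const_mul ((p * R) ^ p))) fun x =>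
    neg_inner_mul_fderiv_norm_rpow_le hp he hR (hφ.differentiable one_ne_zero) (hslab x)
  simp only [Pi.add_apply, Pi.neg_apply] at hmono
  rw [integral_neg, integral_const_mul, integral_inner_mul_fderiv_eq_neg_integral he hg hgs,
    integral_add (hg_int.const_mul _) (hdφ_int.const_mul _), integral_const_mul,
    integral_const_mul] at hmono
  linarith

end PoincareTest

section Sobolev

variable {d : ℕ} {Ω : Set (E d)}

namespace IsTestFunction

variable {φ : E d → ℝ} (hφ : IsTestFunction Ω φ)

include hφ

theorem contDiff_one : ContDiff ℝ 1 φ := hφ.1.of_le (by exact_mod_cast le_top)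

theorem continuous_fderiv_apply (v : E d) : Continuous fun x => fderiv ℝ φ x v :=
  (hφ.1.continuous_fderiv (by simp)).clm_apply continuous_const

theorem hasCompactSupport_fderiv_apply (v : E d) : HasCompactSupport fun x => fderiv ℝ φ x v :=
  hφ.2.1.fderiv_apply (𝕜 := ℝ) v

theorem eq_zero_of_notMem {x : E d} (hx : x ∉ Ω) : φ x = 0 :=
  image_eq_zero_of_notMem_tsupport fun hxs => hx (hφ.2.2 hxs)

theorem fderiv_eq_zero_of_notMem {x : E d} (hx : x ∉ Ω) : fderiv ℝ φ x = 0 :=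
  image_eq_zero_of_notMem_tsupport fun hxs => hx (hφ.2.2 (tsupport_fderiv_subset ℝ hxs))

end IsTestFunction

theorem fderiv_apply_eq_inner_gradient (u : E d → ℝ) (x v : E d) :
    fderiv ℝ u x v = inner ℝ (gradient u x) v := by
  rw [gradient, InnerProductSpace.toDual_symm_apply]

theorem continuous_gradient {u : E d → ℝ} (hu : ContDiff ℝ 1 u) : Continuous (gradient u) :=
  (InnerProductSpace.toDual ℝ (E d)).symm.continuous.comp (hu.continuous_fderiv one_ne_zero)

theorem isWeakGradient_gradient {u : E d → ℝ} (hu : ContDiff ℝ 1 u) :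
    IsWeakGradient Ω u (gradient u) := by
  intro φ hφ v
  have hdu : Continuous fun x => fderiv ℝ u x v :=
    (hu.continuous_fderiv one_ne_zero).clm_apply continuous_const
  have h := integral_mul_fderiv_eq_neg_fderiv_mul_of_integrable (μ := volume) (v := v)
    (f := u) (g := φ)
    ((hdu.mul hφ.1.continuous).integrable_of_hasCompactSupport hφ.2.1.mul_left)
    ((hu.continuous.mul (hφ.continuous_fderiv_apply v)).integrable_of_hasCompactSupport
      (hφ.hasCompactSupport_fderiv_apply v).mul_left)
    ((hu.continuous.mul hφ.1.continuous).integrable_of_hasCompactSupport hφ.2.1.mul_left)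
    (fun x _ => hu.differentiable one_ne_zero x) (fun x _ => hφ.1.differentiable (by simp) x)
  rw [setIntegral_eq_integral_of_forall_compl_eq_zero fun x hx => by
      simp [hφ.fderiv_eq_zero_of_notMem hx],
    setIntegral_eq_integral_of_forall_compl_eq_zero fun x hx => by
      simp [hφ.eq_zero_of_notMem hx], h]
  simp only [fderiv_apply_eq_inner_gradient]

theorem IsWeakGradient.congr_ae {u u' : E d → ℝ} {G G' : E d → E d} (h : IsWeakGradient Ω u G)
    (hu : u =ᵐ[volume.restrict Ω] u') (hG : G =ᵐ[volume.restrict Ω] G') :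
    IsWeakGradient Ω u' G' := by
  intro φ hφ v
  rw [← integral_congr_ae (hu.mono fun x hx => congrArg (· * fderiv ℝ φ x v) hx), h φ hφ v,
    integral_congr_ae (hG.mono fun x hx => congrArg (inner ℝ · v * φ x) hx)]

theorem IsWeakGradient.ae_eq_zero (hΩ : IsOpen Ω) {G : E d → E d} (h : IsWeakGradient Ω 0 G)
    (hG : LocallyIntegrable G (volume.restrict Ω)) : G =ᵐ[volume.restrict Ω] 0 := by
  have hae : ∀ᵐ x ∂volume.restrict Ω, x ∈ Ω → G x = 0 := by
    refine hΩ.ae_eq_zero_of_integral_contDiff_smul_eq_zero (hG.locallyIntegrableOn Ω) ?_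
    intro φ hφ hφs hφΩ
    refine ext_inner_left ℝ fun v => ?_
    have hv := h φ ⟨hφ, hφs, hφΩ⟩ v
    simp only [Pi.zero_apply, zero_mul, integral_zero, zero_eq_neg] at hv
    rw [inner_zero_right, ← hv, ← integral_inner
      (hG.integrable_smul_left_of_hasCompactSupport hφ.continuous hφs)]
    simp only [real_inner_comm _ v, real_inner_smul_left, mul_comm]
  filter_upwards [hae, ae_restrict_mem hΩ.measurableSet] with x hx hxΩ using hx hxΩ

variable {p : ℝ} [hp : Fact (1 < p)]

theorem isClosed_W1p : IsClosed (W1p Ω p : Set (Lp ℝ (ENNReal.ofReal p) (volume.restrict Ω) ×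
      Lp (E d) (ENNReal.ofReal p) (volume.restrict Ω))) := by
  have hset : (W1p Ω p : Set (Lp ℝ (ENNReal.ofReal p) (volume.restrict Ω) ×
      Lp (E d) (ENNReal.ofReal p) (volume.restrict Ω))) =
      ⋂ (φ : E d → ℝ) (_ : IsTestFunction Ω φ) (v : E d), {z |
        ∫ x in Ω, z.1 x * fderiv ℝ φ x v = - ∫ x in Ω, inner ℝ (z.2 x) v * φ x} := by
    ext z
    simp only [Set.mem_iInter, Set.mem_ofPred_eq, SetLike.mem_coe]
    rfl
  rw [hset]
  refine isClosed_iInter fun φ => isClosed_iInter fun hφ => isClosed_iInter fun v => ?_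
  obtain ⟨L, hL⟩ := exists_clm_apply_eq_integral_inner (p := p) (μ := volume.restrict Ω)
    ((hφ.continuous_fderiv_apply v).memLp_of_hasCompactSupport
      (hφ.hasCompactSupport_fderiv_apply v))
  obtain ⟨M, hM⟩ := exists_clm_apply_eq_integral_inner (p := p) (μ := volume.restrict Ω)
    (k := fun x => φ x • v)
    ((hφ.1.continuous.smul continuous_const).memLp_of_hasCompactSupport hφ.2.1.smul_right)
  have hleft (z : Lp ℝ (ENNReal.ofReal p) (volume.restrict Ω)) :
      ∫ x in Ω, z x * fderiv ℝ φ x v = L z := by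
    rw [hL]; simp [mul_comm]
  have hright (z : Lp (E d) (ENNReal.ofReal p) (volume.restrict Ω)) :
      ∫ x in Ω, inner ℝ (z x) v * φ x = M z := by
    rw [hM]; simp [inner_smul_right, mul_comm]
  simp only [hleft, hright]
  exact isClosed_eq (by fun_prop) (by fun_prop)

instance : CompleteSpace (W1p Ω p) := isClosed_W1p.completeSpace_coe

theorem W1p.ext_of_fst_eq (hΩ : IsOpen Ω) {u v : W1p Ω p} (h : u.1.1 = v.1.1) : u = v := by
  have hfst : (u - v).1.1 = 0 := sub_eq_zero.2 h
  have hgrad : IsWeakGradient Ω 0 (u - v).1.2 :=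
    (u - v).2.congr_ae (hfst ▸ Lp.coeFn_zero _ _ _) EventuallyEq.rfl
  have hsnd : (u - v).1.2 = 0 := Lp.ext <|
    (hgrad.ae_eq_zero hΩ ((Lp.memLp (u - v).1.2).locallyIntegrable Fact.out)).trans
      (Lp.coeFn_zero _ _ _).symm
  exact sub_eq_zero.1 (Subtype.ext (Prod.ext hfst hsnd))

theorem W1p.exists_ae_eq_of_contDiff (hΩb : Bornology.IsBounded Ω) {u : E d → ℝ}
    (hu : ContDiff ℝ 1 u) :
    ∃ U : W1p Ω p, U.1.1 =ᵐ[volume.restrict Ω] u ∧ U.1.2 =ᵐ[volume.restrict Ω] gradient u := by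
  have hu_mem : MemLp u (ENNReal.ofReal p) (volume.restrict Ω) :=
    memLp_restrict_of_continuous hΩb hu.continuous _
  have hG_mem : MemLp (gradient u) (ENNReal.ofReal p) (volume.restrict Ω) :=
    memLp_restrict_of_continuous hΩb (continuous_gradient hu) _
  exact ⟨⟨(hu_mem.toLp, hG_mem.toLp), (isWeakGradient_gradient hu).congr_ae
    hu_mem.coeFn_toLp.symm hG_mem.coeFn_toLp.symm⟩, hu_mem.coeFn_toLp, hG_mem.coeFn_toLp⟩

theorem W1p.gradient_ae_eq_of_contDiff (hΩ : IsOpen Ω) (hΩb : Bornology.IsBounded Ω) {u : E d → ℝ}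
    (hu : ContDiff ℝ 1 u) {U : W1p Ω p} (hU : U.1.1 =ᵐ[volume.restrict Ω] u) :
    U.1.2 =ᵐ[volume.restrict Ω] gradient u := by
  obtain ⟨U', hfst, hsnd⟩ := W1p.exists_ae_eq_of_contDiff (p := p) hΩb hu
  rwa [W1p.ext_of_fst_eq hΩ (Lp.ext (hU.trans hfst.symm))]

theorem exists_norm_rpow_le_of_mem_testSubmodule (hd : 0 < d) (hΩ : IsOpen Ω)
    (hΩb : Bornology.IsBounded Ω) :
    ∃ C : ℝ, 0 ≤ C ∧ ∀ v ∈ testSubmodule Ω p, ‖v.1.1‖ ^ p ≤ C ^ p * ‖v.1.2‖ ^ p := by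
  have hp0 : 0 < p := one_pos.trans hp.out
  obtain ⟨R, hR0, hR⟩ := hΩb.exists_pos_norm_le
  refine ⟨p * R, by positivity, fun v ⟨φ, hφ, hvφ⟩ => ?_⟩
  have he : ‖(EuclideanSpace.single ⟨0, hd⟩ 1 : E d)‖ = 1 := by simp
  have hfst : ∫ x in Ω, ‖v.1.1 x‖ ^ p = ∫ x, ‖φ x‖ ^ p := by
    rw [← setIntegral_eq_integral_of_forall_compl_eq_zero (s := Ω) (f := fun x => ‖φ x‖ ^ p)
      fun x hx => by simp [hφ.eq_zero_of_notMem hx, hp0.ne']]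
    exact integral_congr_ae (hvφ.mono fun x hx => by simp only [hx])
  have hsnd : ∫ x in Ω, ‖v.1.2 x‖ ^ p = ∫ x, ‖fderiv ℝ φ x‖ ^ p := by
    rw [← setIntegral_eq_integral_of_forall_compl_eq_zero (s := Ω)
      (f := fun x => ‖fderiv ℝ φ x‖ ^ p)
      fun x hx => by simp [hφ.fderiv_eq_zero_of_notMem hx, hp0.ne']]
    refine integral_congr_ae
      ((W1p.gradient_ae_eq_of_contDiff hΩ hΩb hφ.contDiff_one hvφ).mono fun x hx => ?_)
    simp only [hx, gradient, LinearIsometryEquiv.norm_map]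
  rw [Lp_norm_rpow_eq_integral hp0, Lp_norm_rpow_eq_integral hp0, hfst, hsnd]
  refine integral_norm_rpow_le_integral_norm_fderiv_rpow hp.out he hR0.le hφ.contDiff_one hφ.2.1
    fun x hx => ?_
  have hxΩ : x ∈ Ω := not_not.1 (mt hφ.eq_zero_of_notMem hx)
  exact (abs_real_inner_le_norm _ x).trans (by rw [he, one_mul]; exact hR x hxΩ)

theorem exists_norm_fst_le_of_mem_W01p (hd : 0 < d) (hΩ : IsOpen Ω) (hΩb : Bornology.IsBounded Ω) :
    ∃ C : ℝ, 0 ≤ C ∧ ∀ v ∈ W01p Ω p, ‖v.1.1‖ ≤ C * ‖v.1.2‖ := by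
  have hp0 : 0 < p := one_pos.trans hp.out
  obtain ⟨C, hC, hbound⟩ := exists_norm_rpow_le_of_mem_testSubmodule (p := p) hd hΩ hΩb
  refine ⟨C, hC, fun v hv => ?_⟩
  have hcl : IsClosed {v : W1p Ω p | ‖v.1.1‖ ≤ C * ‖v.1.2‖} :=
    isClosed_le (by fun_prop) (by fun_prop)
  refine closure_minimal (fun v hv => ?_) hcl hv
  rw [Set.mem_ofPred_eq, ← Real.rpow_le_rpow_iff (norm_nonneg _) (by positivity) hp0,
    Real.mul_rpow hC (norm_nonneg _)]
  exact hbound v hv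

end Sobolev

/-! ### Convexity of the power `‖·‖ ^ p` -/

section Pointwise

variable {p : ℝ}

theorem norm_rpow_sub_two_mul_norm {V : Type*} [NormedAddCommGroup V] (hp : 1 < p) (a : V) :
    ‖a‖ ^ (p - 2) * ‖a‖ = ‖a‖ ^ (p - 1) := by
  rw [← Real.rpow_add_one' (norm_nonneg a) (by linarith)]
  ring_nf

theorem norm_rpow_sub_one_mul_norm {V : Type*} [NormedAddCommGroup V] (hp : 0 < p) (a : V) :
    ‖a‖ ^ (p - 1) * ‖a‖ = ‖a‖ ^ p := by
  rw [← Real.rpow_add_one' (norm_nonneg a) (by linarith), sub_add_cancel]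

theorem young_rpow_weighted (hp : 1 < p) {s A B : ℝ} (hs : 0 < s) (hA : 0 ≤ A) (hB : 0 ≤ B) :
    p * (A ^ (p - 1) * B) ≤ (p - 1) * (s ^ (-(1 / (p - 1))) * A ^ p) + s * B ^ p := by
  have hp1 : p - 1 ≠ 0 := by linarith
  have hp0 : p ≠ 0 := by linarith
  set l := s ^ (-(1 / (p * (p - 1))))
  set m := s ^ (1 / p)
  have hl : l ^ p = s ^ (-(1 / (p - 1))) := by
    rw [← Real.rpow_mul hs.le]; congr 1; field_simp
  have hm : m ^ p = s := by rw [← Real.rpow_mul hs.le, one_div_mul_cancel hp0, Real.rpow_one]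
  have hlm : l ^ (p - 1) * m = 1 := by
    have hexp : -(1 / (p * (p - 1))) * (p - 1) + 1 / p = 0 := by field_simp; ring
    rw [← Real.rpow_mul hs.le, ← Real.rpow_add hs, hexp, Real.rpow_zero]
  have hl0 : 0 ≤ l := by positivity
  have hm0 : 0 ≤ m := by positivity
  calc p * (A ^ (p - 1) * B) = p * ((l * A) ^ (p - 1) * (m * B)) := by
        rw [Real.mul_rpow hl0 hA]; linear_combination -(p * A ^ (p - 1) * B) * hlm
    _ ≤ (p - 1) * (l * A) ^ p + (m * B) ^ p :=
        young_rpow hp (mul_nonneg hl0 hA) (mul_nonneg hm0 hB)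
    _ = (p - 1) * (s ^ (-(1 / (p - 1))) * A ^ p) + s * B ^ p := by
        rw [Real.mul_rpow hl0 hA, Real.mul_rpow hm0 hB, hl, hm]

section Inner

variable {V : Type*} [NormedAddCommGroup V] [InnerProductSpace ℝ V]

theorem norm_rpow_sub_two_mul_inner_self (hp : 1 < p) (a : V) :
    ‖a‖ ^ (p - 2) * inner ℝ a a = ‖a‖ ^ p := by
  rw [real_inner_self_eq_norm_sq, sq, ← mul_assoc, norm_rpow_sub_two_mul_norm hp,
    norm_rpow_sub_one_mul_norm (one_pos.trans hp)]

theorem abs_norm_rpow_sub_two_mul_inner_le (hp : 1 < p) (a c : V) :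
    |‖a‖ ^ (p - 2) * inner ℝ a c| ≤ ‖a‖ ^ (p - 1) * ‖c‖ := by
  rw [abs_mul, abs_of_nonneg (by positivity), ← norm_rpow_sub_two_mul_norm hp, mul_assoc]
  exact mul_le_mul_of_nonneg_left (abs_real_inner_le_norm a c) (by positivity)

/-- For `p < 2` the factor `‖a‖ ^ (p - 2)` is singular at `a = 0`; the product is the derivative
of the continuously differentiable function `‖·‖ ^ p / p`. -/
theorem continuous_norm_rpow_sub_two_mul_inner (hp : 1 < p) (c : V) :
    Continuous fun a : V => ‖a‖ ^ (p - 2) * inner ℝ a c := by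
  have hderiv : Continuous fun a : V => p⁻¹ * fderiv ℝ (fun x : V => ‖x‖ ^ p) a c :=
    continuous_const.mul
      (((contDiff_norm_rpow hp).continuous_fderiv one_ne_zero).clm_apply continuous_const)
  refine hderiv.congr fun a => ?_
  rw [fderiv_norm_rpow a hp, smul_apply, innerSL_apply_apply, smul_eq_mul,
    mul_assoc, inv_mul_cancel_left₀ (by linarith)]

theorem mul_norm_rpow_sub_two_mul_inner_le (hp : 1 < p) {s : ℝ} (hs : 0 < s) (a b : V) :
    p * (‖a‖ ^ (p - 2) * inner ℝ a b) ≤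
      (p - 1) * (s ^ (-(1 / (p - 1))) * ‖a‖ ^ p) + s * ‖b‖ ^ p := by
  refine le_trans (mul_le_mul_of_nonneg_left ?_ (by linarith))
    (young_rpow_weighted hp hs (norm_nonneg a) (norm_nonneg b))
  exact (le_abs_self _).trans (abs_norm_rpow_sub_two_mul_inner_le hp a b)

theorem norm_rpow_add_le_norm_rpow (hp : 1 < p) (a b : V) :
    ‖a‖ ^ p + p * (‖a‖ ^ (p - 2) * inner ℝ a (b - a)) ≤ ‖b‖ ^ p := by
  have h := mul_norm_rpow_sub_two_mul_inner_le hp one_pos a b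
  rw [Real.one_rpow, one_mul, one_mul] at h
  rw [inner_sub_right, mul_sub, norm_rpow_sub_two_mul_inner_self hp]
  linarith

end Inner

/-- The convexity defect of `‖·‖ ^ p` at the midpoint of `a` and `b`. It is coercive in `a - b`,
which replaces the uniform convexity of `L ^ p` in the direct method. -/
noncomputable def midpointGap {V : Type*} [NormedAddCommGroup V] [NormedSpace ℝ V] (p : ℝ)
    (a b : V) : ℝ :=
  (‖a‖ ^ p + ‖b‖ ^ p) / 2 - ‖(1 / 2 : ℝ) • (a + b)‖ ^ p

section MidpointGap

variable {V : Type*} [NormedAddCommGroup V] [NormedSpace ℝ V]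

theorem norm_smul_rpow_of_nonneg {r : ℝ} (hr : 0 ≤ r) (p : ℝ) (a : V) :
    ‖r • a‖ ^ p = r ^ p * ‖a‖ ^ p := by
  rw [norm_smul, Real.norm_of_nonneg hr, Real.mul_rpow hr (norm_nonneg a)]

theorem midpointGap_smul {r : ℝ} (hr : 0 ≤ r) (a b : V) :
    midpointGap p (r • a) (r • b) = r ^ p * midpointGap p a b := by
  rw [midpointGap, ← smul_add, smul_comm _ r]
  simp only [norm_smul_rpow_of_nonneg hr, midpointGap]
  ring

theorem continuous_midpointGap (hp : 0 ≤ p) :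
    Continuous fun z : V × V => midpointGap p z.1 z.2 := by
  have hpow {f : V × V → V} (hf : Continuous f) : Continuous fun z => ‖f z‖ ^ p :=
    hf.norm.rpow_const fun _ => Or.inr hp
  exact (((hpow continuous_fst).add (hpow continuous_snd)).div_const 2).sub (hpow (by fun_prop))

theorem midpointGap_pos [StrictConvexSpace ℝ V] (hp : 1 < p) {a b : V} (hab : a ≠ b) :
    0 < midpointGap p a b := by
  have hp0 : 0 < p := by linarith
  refine sub_pos.2 ?_
  by_cases h : ‖a‖ = ‖b‖
  · have := Real.rpow_lt_rpow (norm_nonneg _) ((norm_midpoint_lt_iff h).2 hab) hp0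
    rw [← h]
    linarith
  · have htri : ‖(1 / 2 : ℝ) • (a + b)‖ ≤ (1 / 2) * ‖a‖ + (1 / 2) * ‖b‖ := by
      rw [norm_smul, Real.norm_of_nonneg (by norm_num : (0 : ℝ) ≤ 1 / 2)]
      linarith [norm_add_le a b]
    have hconv := (strictConvexOn_rpow hp).2 (Set.mem_Ici.2 (norm_nonneg a))
      (Set.mem_Ici.2 (norm_nonneg b)) h (by norm_num : (0 : ℝ) < 1 / 2)
      (by norm_num : (0 : ℝ) < 1 / 2) (by norm_num)
    simp only [smul_eq_mul] at hconv
    linarith [Real.rpow_le_rpow (norm_nonneg _) htri hp0.le]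

theorem midpointGap_nonneg [StrictConvexSpace ℝ V] (hp : 1 < p) (a b : V) :
    0 ≤ midpointGap p a b := by
  rcases eq_or_ne a b with rfl | hab
  · have hmid : (1 / 2 : ℝ) • (a + a) = a := by module
    rw [midpointGap, hmid]
    linarith
  · exact (midpointGap_pos hp hab).le

theorem exists_forall_lt_mul_of_isCompact {X : Type*} [TopologicalSpace X] {K : Set X}
    (hK : IsCompact K) {f g : X → ℝ} (hf : Continuous f) (hg : Continuous g)
    (hg0 : ∀ x, 0 ≤ g x) (hfg : ∀ x ∈ K, g x = 0 → f x < 0) :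
    ∃ n : ℕ, ∀ x ∈ K, f x < n * g x := by
  refine hK.elim_directed_cover (fun n : ℕ => {x | f x < n * g x})
    (fun n => isOpen_lt hf (continuous_const.mul hg)) (fun x hx => Set.mem_iUnion.2 ?_)
    (Monotone.directed_le fun m n hmn x hx => ?_)
  · rcases (hg0 x).eq_or_lt with hx0 | hx0
    · exact ⟨0, by simpa using hfg x hx hx0.symm⟩
    · obtain ⟨n, hn⟩ := exists_nat_gt (f x / g x)
      exact ⟨n, (div_lt_iff₀ hx0).1 hn⟩
  · exact lt_of_lt_of_le hx (mul_le_mul_of_nonneg_right (Nat.cast_le.2 hmn) (hg0 x))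

theorem exists_norm_sub_rpow_le_of_norm_eq_one [StrictConvexSpace ℝ V] [FiniteDimensional ℝ V]
    (hp : 1 < p) {ε : ℝ} (hε : 0 < ε) :
    ∃ C : ℝ, 0 ≤ C ∧ ∀ z : V × V, ‖z‖ = 1 →
      ‖z.1 - z.2‖ ^ p ≤ ε * (‖z.1‖ ^ p + ‖z.2‖ ^ p) + C * midpointGap p z.1 z.2 := by
  have hp0 : 0 < p := by linarith
  have hpow {f : V × V → V} (hf : Continuous f) : Continuous fun z => ‖f z‖ ^ p :=
    hf.norm.rpow_const fun _ => Or.inr hp0.le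
  have hdiag : ∀ z ∈ Metric.sphere (0 : V × V) 1, midpointGap p z.1 z.2 = 0 →
      ‖z.1 - z.2‖ ^ p - ε * (‖z.1‖ ^ p + ‖z.2‖ ^ p) < 0 := by
    rintro ⟨a, b⟩ hz hgap
    obtain rfl : a = b := by_contra fun hab => (midpointGap_pos hp hab).ne' hgap
    have ha : ‖a‖ = 1 := by simpa [Prod.norm_def] using hz
    simpa [ha, Real.zero_rpow hp0.ne'] using hε
  have hcont : Continuous fun z : V × V => ‖z.1 - z.2‖ ^ p - ε * (‖z.1‖ ^ p + ‖z.2‖ ^ p) :=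
    (hpow (by fun_prop)).sub
      (continuous_const.mul ((hpow continuous_fst).add (hpow continuous_snd)))
  obtain ⟨n, hn⟩ := exists_forall_lt_mul_of_isCompact (isCompact_sphere (0 : V × V) 1) hcont
    (continuous_midpointGap hp0.le) (fun z => midpointGap_nonneg hp z.1 z.2) hdiag
  refine ⟨n, n.cast_nonneg, fun z hz => ?_⟩
  linarith [hn z (by simpa using hz)]

theorem exists_norm_sub_rpow_le [StrictConvexSpace ℝ V] [FiniteDimensional ℝ V] (hp : 1 < p)
    {ε : ℝ} (hε : 0 < ε) :
    ∃ C : ℝ, 0 ≤ C ∧ ∀ a b : V,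
      ‖a - b‖ ^ p ≤ ε * (‖a‖ ^ p + ‖b‖ ^ p) + C * midpointGap p a b := by
  obtain ⟨C, hC, hsphere⟩ := exists_norm_sub_rpow_le_of_norm_eq_one (V := V) hp hε
  refine ⟨C, hC, fun a b => ?_⟩
  rcases eq_or_ne ((a, b) : V × V) 0 with h0 | h0
  · obtain ⟨rfl, rfl⟩ := Prod.mk_eq_zero.1 h0
    simp [midpointGap, Real.zero_rpow (by linarith : p ≠ 0)]
  have hr : 0 < ‖((a, b) : V × V)‖⁻¹ := inv_pos.2 (norm_pos_iff.2 h0)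
  have h := hsphere _ (norm_smul_inv_norm (𝕜 := ℝ) h0)
  simp only [RCLike.ofReal_real_eq_id, id, Prod.smul_fst, Prod.smul_snd, ← smul_sub,
    norm_smul_rpow_of_nonneg hr.le, midpointGap_smul hr.le] at h
  refine le_of_mul_le_mul_left (h.trans (le_of_eq ?_)) (Real.rpow_pos_of_pos hr p)
  ring

end MidpointGap

end Pointwise

/-! ### Energy minimizers and the Dirichlet to Neumann map -/

section Energy

variable {d : ℕ} {Ω : Set (E d)} {p : ℝ} [hp : Fact (1 < p)] {σ : E d → ℝ} {a b : ℝ}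

/-- A conductivity on `Ω`: a measurable coefficient which lies almost everywhere between the
constants `a > 0` and `b`. -/
structure IsConductivity (Ω : Set (E d)) (σ : E d → ℝ) (a b : ℝ) : Prop where
  aemeasurable : AEMeasurable σ (volume.restrict Ω)
  pos : 0 < a
  bounds : ∀ᵐ x ∂volume.restrict Ω, a ≤ σ x ∧ σ x ≤ b

theorem gradient_sub_ae (u v : W1p Ω p) :
    ∀ᵐ x ∂volume.restrict Ω, (u - v).1.2 x = u.1.2 x - v.1.2 x :=
  Lp.coeFn_sub u.1.2 v.1.2

theorem gradient_add_ae (u v : W1p Ω p) :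
    ∀ᵐ x ∂volume.restrict Ω, (u + v).1.2 x = u.1.2 x + v.1.2 x :=
  Lp.coeFn_add u.1.2 v.1.2

theorem gradient_smul_ae (c : ℝ) (u : W1p Ω p) :
    ∀ᵐ x ∂volume.restrict Ω, (c • u).1.2 x = c • u.1.2 x :=
  Lp.coeFn_smul c u.1.2

theorem flux_self (u : W1p Ω p) : flux Ω p σ u u = energy Ω p σ u := by
  simp only [flux, energy, mul_assoc, norm_rpow_sub_two_mul_inner_self hp.out]

theorem boundaryValue_eq_iff {u v : W1p Ω p} :
    boundaryValue Ω p u = boundaryValue Ω p v ↔ u - v ∈ W01p Ω p :=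
  Submodule.Quotient.eq _

theorem boundaryValue_midpoint {f : BoundarySpace Ω p} {u v : W1p Ω p}
    (hu : boundaryValue Ω p u = f) (hv : boundaryValue Ω p v = f) :
    boundaryValue Ω p ((1 / 2 : ℝ) • (u + v)) = f := by
  rw [← hv, boundaryValue_eq_iff] at hu ⊢
  rw [show (1 / 2 : ℝ) • (u + v) - v = (1 / 2 : ℝ) • (u - v) by module]
  exact Submodule.smul_mem _ _ hu

theorem isClosed_boundaryValue_eq (f : BoundarySpace Ω p) :
    IsClosed {v : W1p Ω p | boundaryValue Ω p v = f} := by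
  obtain ⟨u, rfl⟩ : ∃ u, boundaryValue Ω p u = f := Submodule.Quotient.mk_surjective _ f
  simp only [boundaryValue_eq_iff]
  exact (testSubmodule Ω p).isClosed_topologicalClosure.preimage
    (continuous_id.sub continuous_const)

theorem exists_norm_le_of_mem_W01p (hd : 0 < d) (hΩ : IsOpen Ω) (hΩb : Bornology.IsBounded Ω) :
    ∃ K : ℝ, 0 < K ∧ ∀ v ∈ W01p Ω p, ‖v‖ ≤ K * ‖v.1.2‖ := by
  obtain ⟨C, hC, hpoincare⟩ := exists_norm_fst_le_of_mem_W01p (p := p) hd hΩ hΩb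
  refine ⟨C + 1, by positivity, fun v hv => max_le ((hpoincare v hv).trans ?_) ?_⟩
  · exact mul_le_mul_of_nonneg_right (by linarith) (norm_nonneg _)
  · exact le_mul_of_one_le_left (norm_nonneg _) (by linarith)

namespace IsConductivity

theorem one : IsConductivity Ω (fun _ => (1 : ℝ)) 1 1 :=
  ⟨aemeasurable_const, one_pos, ae_of_all _ fun _ => ⟨le_rfl, le_rfl⟩⟩

theorem norm_le (hσ : IsConductivity Ω σ a b) : ∀ᵐ x ∂volume.restrict Ω, ‖σ x‖ ≤ b :=
  hσ.bounds.mono fun x hx => by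
    rw [Real.norm_of_nonneg (hσ.pos.le.trans hx.1)]; exact hx.2

theorem integrable_energy (hσ : IsConductivity Ω σ a b)
    (G : Lp (E d) (ENNReal.ofReal p) (volume.restrict Ω)) :
    Integrable (fun x => σ x * ‖G x‖ ^ p) (volume.restrict Ω) :=
  (integrable_norm_rpow_of_memLp (one_pos.trans hp.out) (Lp.memLp G)).bdd_mul
    hσ.aemeasurable.aestronglyMeasurable hσ.norm_le

theorem memLp_flux (hσ : IsConductivity Ω σ a b)
    (G : Lp (E d) (ENNReal.ofReal p) (volume.restrict Ω)) :
    MemLp (fun x => σ x • ‖G x‖ ^ (p - 2) • G x) (ENNReal.ofReal p.conjExponent)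
      (volume.restrict Ω) := by
  have hp1 : 0 < p - 1 := sub_pos.2 hp.out
  have hG := Lp.aestronglyMeasurable G
  have hmeas : AEStronglyMeasurable (fun x => ‖G x‖ ^ (p - 2) • G x) (volume.restrict Ω) :=
    (hG.norm.aemeasurable.pow_const (p - 2)).aestronglyMeasurable.smul hG
  have hpow := (Lp.memLp G).norm_rpow_div (ENNReal.ofReal (p - 1))
  rw [ENNReal.toReal_ofReal hp1.le, ← ENNReal.ofReal_div_of_pos hp1] at hpow
  refine hpow.of_le_mul (c := b) (hσ.aemeasurable.aestronglyMeasurable.smul hmeas) ?_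
  filter_upwards [hσ.norm_le] with x hx
  rw [norm_smul, norm_smul, Real.norm_of_nonneg (by positivity : 0 ≤ ‖G x‖ ^ (p - 2)),
    norm_rpow_sub_two_mul_norm hp.out, Real.norm_of_nonneg (by positivity : 0 ≤ ‖G x‖ ^ (p - 1))]
  exact mul_le_mul_of_nonneg_right hx (by positivity)

theorem integrable_flux (hσ : IsConductivity Ω σ a b)
    (G H : Lp (E d) (ENNReal.ofReal p) (volume.restrict Ω)) :
    Integrable (fun x => σ x * ‖G x‖ ^ (p - 2) * inner ℝ (G x) (H x)) (volume.restrict Ω) := by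
  have : (ENNReal.ofReal p).HolderConjugate (ENNReal.ofReal p.conjExponent) :=
    (Real.HolderConjugate.conjExponent hp.out).ennrealOfReal
  have h := (innerSL ℝ (E := E d)).memLp_of_bilin 1 (Lp.memLp H) (hσ.memLp_flux G)
  refine (memLp_one_iff_integrable.1 h).congr (ae_of_all _ fun x => ?_)
  change inner ℝ (H x) (σ x • ‖G x‖ ^ (p - 2) • G x) = _
  rw [inner_smul_right, inner_smul_right, real_inner_comm]
  exact (mul_assoc _ _ _).symm

theorem exists_clm_flux (hσ : IsConductivity Ω σ a b) (u : W1p Ω p) :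
    ∃ L : W1p Ω p →L[ℝ] ℝ, ∀ g, L g = flux Ω p σ u g := by
  obtain ⟨L, hL⟩ := exists_clm_apply_eq_integral_inner (hσ.memLp_flux u.1.2)
  refine ⟨L.comp ((ContinuousLinearMap.snd ℝ _ _).comp (W1p Ω p).subtypeL), fun g => ?_⟩
  simp only [ContinuousLinearMap.comp_apply, Submodule.subtypeL_apply,
    ContinuousLinearMap.coe_snd', hL, flux]
  refine integral_congr_ae (ae_of_all _ fun x => ?_)
  simp only [inner_smul_right, real_inner_comm (g.1.2 x)]
  ring

theorem flux_smul (hσ : IsConductivity Ω σ a b) (u g : W1p Ω p) (c : ℝ) :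
    flux Ω p σ u (c • g) = c * flux Ω p σ u g := by
  obtain ⟨L, hL⟩ := hσ.exists_clm_flux u
  rw [← hL, ← hL, map_smul, smul_eq_mul]

theorem flux_sub (hσ : IsConductivity Ω σ a b) (u g h : W1p Ω p) :
    flux Ω p σ u (g - h) = flux Ω p σ u g - flux Ω p σ u h := by
  obtain ⟨L, hL⟩ := hσ.exists_clm_flux u
  rw [← hL, ← hL, ← hL, map_sub]

theorem energy_nonneg (hσ : IsConductivity Ω σ a b) (u : W1p Ω p) : 0 ≤ energy Ω p σ u :=
  integral_nonneg_of_ae <| hσ.bounds.mono fun x hx =>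
    mul_nonneg (hσ.pos.le.trans hx.1) (by positivity)

theorem energy_add_flux_le_energy (hσ : IsConductivity Ω σ a b) (u v : W1p Ω p) :
    energy Ω p σ u + p * flux Ω p σ u (v - u) ≤ energy Ω p σ v := by
  have hu := hσ.integrable_energy u.1.2
  have hflux := (hσ.integrable_flux u.1.2 (v - u).1.2).const_mul p
  rw [energy, flux, ← integral_const_mul, ← integral_add hu hflux]
  refine integral_mono_ae (hu.add hflux) (hσ.integrable_energy v.1.2) ?_
  filter_upwards [hσ.bounds, gradient_sub_ae v u] with x hx hsub
  have h := mul_le_mul_of_nonneg_left (norm_rpow_add_le_norm_rpow hp.out (u.1.2 x) (v.1.2 x))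
    (hσ.pos.le.trans hx.1)
  rw [hsub]
  linarith

theorem ae_mul_midpointGap_eq (u v : W1p Ω p) : ∀ᵐ x ∂volume.restrict Ω,
    σ x * midpointGap p (u.1.2 x) (v.1.2 x) = (σ x * ‖u.1.2 x‖ ^ p + σ x * ‖v.1.2 x‖ ^ p) / 2 -
      σ x * ‖((1 / 2 : ℝ) • (u + v)).1.2 x‖ ^ p := by
  filter_upwards [gradient_add_ae u v, gradient_smul_ae (1 / 2 : ℝ) (u + v)] with x hadd hsmul
  rw [hsmul, hadd, midpointGap]
  ring

theorem integrable_mul_midpointGap (hσ : IsConductivity Ω σ a b) (u v : W1p Ω p) :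
    Integrable (fun x => σ x * midpointGap p (u.1.2 x) (v.1.2 x)) (volume.restrict Ω) :=
  ((((hσ.integrable_energy u.1.2).add (hσ.integrable_energy v.1.2)).div_const 2).sub
    (hσ.integrable_energy ((1 / 2 : ℝ) • (u + v)).1.2)).congr
      ((ae_mul_midpointGap_eq u v).mono fun _ hx => hx.symm)

theorem integral_mul_midpointGap (hσ : IsConductivity Ω σ a b) (u v : W1p Ω p) :
    ∫ x in Ω, σ x * midpointGap p (u.1.2 x) (v.1.2 x) =
      (energy Ω p σ u + energy Ω p σ v) / 2 - energy Ω p σ ((1 / 2 : ℝ) • (u + v)) := by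
  have hu := hσ.integrable_energy u.1.2
  have hv := hσ.integrable_energy v.1.2
  have hsum : Integrable (fun x => (σ x * ‖u.1.2 x‖ ^ p + σ x * ‖v.1.2 x‖ ^ p) / 2)
      (volume.restrict Ω) := (hu.add hv).div_const 2
  simp only [energy]
  rw [integral_congr_ae (ae_mul_midpointGap_eq u v), integral_sub hsum (hσ.integrable_energy _),
    integral_div, integral_add hu hv]

theorem exists_norm_gradient_sub_le (hσ : IsConductivity Ω σ a b) {ε : ℝ} (hε : 0 < ε) :
    ∃ C : ℝ, 0 ≤ C ∧ ∀ u v : W1p Ω p,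
      a * ‖(u - v).1.2‖ ^ p ≤ ε * (energy Ω p σ u + energy Ω p σ v) +
        C * ((energy Ω p σ u + energy Ω p σ v) / 2 - energy Ω p σ ((1 / 2 : ℝ) • (u + v))) := by
  obtain ⟨C, hC, hconvex⟩ := exists_norm_sub_rpow_le (V := E d) hp.out hε
  refine ⟨C, hC, fun u v => ?_⟩
  have hp0 : 0 < p := one_pos.trans hp.out
  have hu := hσ.integrable_energy u.1.2
  have hv := hσ.integrable_energy v.1.2
  have hgap := (hσ.integrable_mul_midpointGap u v).const_mul C
  have hpointwise : ∀ᵐ x ∂volume.restrict Ω, a * ‖(u - v).1.2 x‖ ^ p ≤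
      ε * (σ x * ‖u.1.2 x‖ ^ p + σ x * ‖v.1.2 x‖ ^ p) +
        C * (σ x * midpointGap p (u.1.2 x) (v.1.2 x)) := by
    filter_upwards [hσ.bounds, gradient_sub_ae u v] with x hx hsub
    rw [hsub]
    have h := mul_le_mul hx.1 (hconvex (u.1.2 x) (v.1.2 x)) (by positivity)
      (hσ.pos.le.trans hx.1)
    linarith
  have hleft := (integrable_norm_rpow_of_memLp hp0 (Lp.memLp (u - v).1.2)).const_mul a
  have hsum : Integrable (fun x => ε * (σ x * ‖u.1.2 x‖ ^ p + σ x * ‖v.1.2 x‖ ^ p))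
      (volume.restrict Ω) := (hu.add hv).const_mul ε
  have hsum_eq : ∫ x in Ω, ε * (σ x * ‖u.1.2 x‖ ^ p + σ x * ‖v.1.2 x‖ ^ p) =
      ε * (energy Ω p σ u + energy Ω p σ v) := by
    rw [integral_const_mul, integral_add hu hv, energy, energy]
  have hgap_eq := integral_const_mul (μ := volume.restrict Ω) C
    fun x => σ x * midpointGap p (u.1.2 x) (v.1.2 x)
  rw [hσ.integral_mul_midpointGap] at hgap_eq
  calc a * ‖(u - v).1.2‖ ^ p
    _ = ∫ x in Ω, a * ‖(u - v).1.2 x‖ ^ p := by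
      rw [integral_const_mul, Lp_norm_rpow_eq_integral hp0]
    _ ≤ ∫ x in Ω, (ε * (σ x * ‖u.1.2 x‖ ^ p + σ x * ‖v.1.2 x‖ ^ p) +
        C * (σ x * midpointGap p (u.1.2 x) (v.1.2 x))) :=
      integral_mono_ae hleft (hsum.add hgap) hpointwise
    _ = ε * (energy Ω p σ u + energy Ω p σ v) + C * ((energy Ω p σ u + energy Ω p σ v) / 2 -
        energy Ω p σ ((1 / 2 : ℝ) • (u + v))) :=
      (integral_add hsum hgap).trans (congrArg₂ (· + ·) hsum_eq hgap_eq)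

theorem exists_forall_norm_gradient_sub_lt (hσ : IsConductivity Ω σ a b) {m δ : ℝ} (hm : 0 ≤ m)
    (hδ : 0 < δ) : ∃ η, 0 < η ∧ ∀ u v : W1p Ω p, energy Ω p σ u < m + η →
      energy Ω p σ v < m + η → m ≤ energy Ω p σ ((1 / 2 : ℝ) • (u + v)) →
      ‖(u - v).1.2‖ < δ := by
  set A := a * δ ^ p
  have hA0 : 0 < A := mul_pos hσ.pos (by positivity)
  obtain ⟨C, hC, hgap⟩ := hσ.exists_norm_gradient_sub_le (p := p) (ε := A / (4 * (m + 1)))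
    (by positivity)
  refine ⟨min 1 (A / (4 * (C + 1))), by positivity, fun u v hu hv hmid => ?_⟩
  have hη1 : min 1 (A / (4 * (C + 1))) ≤ 1 := min_le_left _ _
  have hη2 : C * min 1 (A / (4 * (C + 1))) ≤ A / 4 := calc
    C * min 1 (A / (4 * (C + 1))) ≤ (C + 1) * (A / (4 * (C + 1))) := by
      gcongr
      · linarith
      · exact min_le_right _ _
    _ = A / 4 := by field_simp
  have hsum : A / (4 * (m + 1)) * (energy Ω p σ u + energy Ω p σ v) ≤ A / 2 := calc
    _ ≤ A / (4 * (m + 1)) * (2 * (m + 1)) := by gcongr; linarith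
    _ = A / 2 := by field_simp; norm_num
  have hdefect : C * ((energy Ω p σ u + energy Ω p σ v) / 2 -
      energy Ω p σ ((1 / 2 : ℝ) • (u + v))) ≤ C * min 1 (A / (4 * (C + 1))) := by
    gcongr
    linarith
  have hlt : a * ‖(u - v).1.2‖ ^ p < a * δ ^ p := by linarith [hgap u v]
  exact (Real.rpow_lt_rpow_iff (norm_nonneg _) hδ.le (one_pos.trans hp.out)).1
    (lt_of_mul_lt_mul_left hlt hσ.pos.le)

theorem cauchySeq_of_tendsto_energy (hσ : IsConductivity Ω σ a b) {v : ℕ → W1p Ω p} {m K : ℝ}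
    (hm : 0 ≤ m) (hK : 0 < K) (hlim : Tendsto (fun n => energy Ω p σ (v n)) atTop (𝓝 m))
    (hmid : ∀ i j, m ≤ energy Ω p σ ((1 / 2 : ℝ) • (v i + v j)))
    (hnorm : ∀ i j, ‖v i - v j‖ ≤ K * ‖(v i - v j).1.2‖) : CauchySeq v := by
  refine Metric.cauchySeq_iff.2 fun δ hδ => ?_
  obtain ⟨η, hη, hclose⟩ := hσ.exists_forall_norm_gradient_sub_lt (p := p) hm (div_pos hδ hK)
  obtain ⟨N, hN⟩ := eventually_atTop.1 (hlim.eventually_lt_const (lt_add_of_pos_right m hη))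
  refine ⟨N, fun i hi j hj => ?_⟩
  rw [dist_eq_norm]
  exact (hnorm i j).trans_lt
    ((lt_div_iff₀' hK).1 (hclose _ _ (hN i hi) (hN j hj) (hmid i j)))

theorem energy_le_of_tendsto (hσ : IsConductivity Ω σ a b) {v : ℕ → W1p Ω p} {u : W1p Ω p} {m : ℝ}
    (hu : Tendsto v atTop (𝓝 u)) (hm : Tendsto (fun n => energy Ω p σ (v n)) atTop (𝓝 m)) :
    energy Ω p σ u ≤ m := by
  obtain ⟨L, hL⟩ := hσ.exists_clm_flux u
  have hlin : Tendsto (fun n => energy Ω p σ u + p * L (v n - u)) atTop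
      (𝓝 (energy Ω p σ u + p * L (u - u))) :=
    (((L.continuous.tendsto _).comp (hu.sub_const u)).const_mul p).const_add _
  rw [sub_self, map_zero, mul_zero, add_zero] at hlin
  refine le_of_tendsto_of_tendsto' hlin hm fun n => ?_
  rw [hL]
  exact hσ.energy_add_flux_le_energy u (v n)

theorem exists_isMinimizer (hσ : IsConductivity Ω σ a b) (hd : 0 < d) (hΩ : IsOpen Ω)
    (hΩb : Bornology.IsBounded Ω) (f : BoundarySpace Ω p) : ∃ u, IsMinimizer Ω p σ f u := by
  obtain ⟨K, hK, hnorm⟩ := exists_norm_le_of_mem_W01p (p := p) hd hΩ hΩb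
  set S := {v : W1p Ω p | boundaryValue Ω p v = f}
  have hne : (energy Ω p σ '' S).Nonempty :=
    Set.Nonempty.image _ (Submodule.Quotient.mk_surjective _ f)
  have hlow : ∀ y ∈ energy Ω p σ '' S, 0 ≤ y := by
    rintro _ ⟨v, -, rfl⟩
    exact hσ.energy_nonneg v
  have hinf (v : W1p Ω p) (hv : v ∈ S) : sInf (energy Ω p σ '' S) ≤ energy Ω p σ v :=
    csInf_le ⟨0, hlow⟩ ⟨v, hv, rfl⟩
  obtain ⟨y, -, hy, hyS⟩ := exists_seq_tendsto_sInf hne ⟨0, hlow⟩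
  choose v hvS hvy using hyS
  obtain rfl : (fun n => energy Ω p σ (v n)) = y := funext hvy
  have hcauchy : CauchySeq v := hσ.cauchySeq_of_tendsto_energy (le_csInf hne hlow) hK hy
    (fun i j => hinf _ (boundaryValue_midpoint (hvS i) (hvS j)))
    (fun i j => hnorm _ (boundaryValue_eq_iff.1 (Eq.trans (hvS i) (Eq.symm (hvS j)))))
  obtain ⟨u, hu⟩ := cauchySeq_tendsto_of_complete hcauchy
  exact ⟨u, (isClosed_boundaryValue_eq f).mem_of_tendsto hu (Eventually.of_forall hvS),
    fun z hz => (hσ.energy_le_of_tendsto hu hy).trans (hinf z hz)⟩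

end IsConductivity

theorem abs_norm_rpow_sub_two_mul_inner_add_smul_le {V : Type*} [NormedAddCommGroup V]
    [InnerProductSpace ℝ V] {p t : ℝ} (hp : 1 < p) (ht0 : 0 ≤ t) (ht1 : t ≤ 1) (x y : V) :
    |‖x + t • y‖ ^ (p - 2) * inner ℝ (x + t • y) y| ≤ (‖x‖ + ‖y‖) ^ p := by
  have hadd : ‖x + t • y‖ ≤ ‖x‖ + ‖y‖ := calc
    ‖x + t • y‖ ≤ ‖x‖ + t * ‖y‖ := by
      simpa only [norm_smul, Real.norm_of_nonneg ht0] using norm_add_le x (t • y)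
    _ ≤ ‖x‖ + ‖y‖ := by gcongr; exact mul_le_of_le_one_left (norm_nonneg _) ht1
  calc |‖x + t • y‖ ^ (p - 2) * inner ℝ (x + t • y) y|
    _ ≤ ‖x + t • y‖ ^ (p - 1) * ‖y‖ := abs_norm_rpow_sub_two_mul_inner_le hp _ _
    _ ≤ (‖x‖ + ‖y‖) ^ (p - 1) * (‖x‖ + ‖y‖) := by
      gcongr
      exact le_add_of_nonneg_left (norm_nonneg _)
    _ = (‖x‖ + ‖y‖) ^ p := by
      rw [← Real.rpow_add_one' (by positivity) (by linarith), sub_add_cancel]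

theorem flux_add_smul_ae_eq (u g : W1p Ω p) (t : ℝ) :
    (fun x => σ x * ‖(u + t • g).1.2 x‖ ^ (p - 2) * inner ℝ ((u + t • g).1.2 x) (g.1.2 x))
      =ᵐ[volume.restrict Ω] fun x =>
        σ x * (‖u.1.2 x + t • g.1.2 x‖ ^ (p - 2) * inner ℝ (u.1.2 x + t • g.1.2 x) (g.1.2 x)) := by
  filter_upwards [gradient_add_ae u (t • g), gradient_smul_ae t g] with x hadd hsmul
  rw [hadd, hsmul, mul_assoc]

theorem IsConductivity.tendsto_flux_add_smul (hσ : IsConductivity Ω σ a b) (u g : W1p Ω p) :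
    Tendsto (fun t : ℝ => flux Ω p σ (u + t • g) g) (𝓝[>] 0) (𝓝 (flux Ω p σ u g)) := by
  have hflux (t : ℝ) : flux Ω p σ (u + t • g) g = ∫ x in Ω,
      σ x * (‖u.1.2 x + t • g.1.2 x‖ ^ (p - 2) * inner ℝ (u.1.2 x + t • g.1.2 x) (g.1.2 x)) :=
    integral_congr_ae (flux_add_smul_ae_eq u g t)
  have hflux0 := hflux 0
  rw [zero_smul, add_zero] at hflux0
  simp only [hflux, hflux0]
  refine tendsto_integral_filter_of_dominated_convergence
    (fun x => b * (‖u.1.2 x‖ + ‖g.1.2 x‖) ^ p) ?_ ?_ ?_ (ae_of_all _ fun x => ?_)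
  · exact Eventually.of_forall fun t =>
      (hσ.integrable_flux _ _).aestronglyMeasurable.congr (flux_add_smul_ae_eq u g t)
  · filter_upwards [Ioo_mem_nhdsGT one_pos] with t ht
    filter_upwards [hσ.norm_le] with x hb
    rw [norm_mul]
    exact mul_le_mul hb
      (abs_norm_rpow_sub_two_mul_inner_add_smul_le hp.out ht.1.le ht.2.le _ _)
      (norm_nonneg _) ((norm_nonneg _).trans hb)
  · have hint := integrable_norm_rpow_of_memLp (one_pos.trans hp.out)
      ((Lp.memLp u.1.2).norm.add (Lp.memLp g.1.2).norm)
    refine (hint.const_mul b).congr (ae_of_all _ fun x => ?_)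
    simp only [Pi.add_apply, Real.norm_of_nonneg (add_nonneg (norm_nonneg _) (norm_nonneg _))]
  · have hcont : Continuous fun t : ℝ =>
        σ x * (‖u.1.2 x + t • g.1.2 x‖ ^ (p - 2) * inner ℝ (u.1.2 x + t • g.1.2 x) (g.1.2 x)) :=
      continuous_const.mul ((continuous_norm_rpow_sub_two_mul_inner hp.out (g.1.2 x)).comp
        (by fun_prop : Continuous fun t : ℝ => u.1.2 x + t • g.1.2 x))
    exact (hcont.tendsto 0).mono_left nhdsWithin_le_nhds

namespace IsMinimizer

variable {f : BoundarySpace Ω p} {u g : W1p Ω p}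

theorem flux_nonneg (hu : IsMinimizer Ω p σ f u) (hσ : IsConductivity Ω σ a b)
    (hg : g ∈ W01p Ω p) : 0 ≤ flux Ω p σ u g := by
  have hp0 : 0 < p := one_pos.trans hp.out
  refine ge_of_tendsto (hσ.tendsto_flux_add_smul u g) ?_
  filter_upwards [self_mem_nhdsWithin] with t (ht : 0 < t)
  have hmem : boundaryValue Ω p (u + t • g) = f := by
    rw [← hu.1, boundaryValue_eq_iff, add_sub_cancel_left]
    exact Submodule.smul_mem _ _ hg
  have hmin := hu.2 _ hmem
  have hconvex := hσ.energy_add_flux_le_energy (u + t • g) u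
  rw [show u - (u + t • g) = (-t) • g by module, hσ.flux_smul] at hconvex
  have hnonneg : 0 ≤ p * t * flux Ω p σ (u + t • g) g := by linarith
  exact nonneg_of_mul_nonneg_right hnonneg (by positivity)

theorem flux_eq_zero (hu : IsMinimizer Ω p σ f u) (hσ : IsConductivity Ω σ a b)
    (hg : g ∈ W01p Ω p) : flux Ω p σ u g = 0 := by
  have hneg := hu.flux_nonneg hσ (Submodule.smul_mem _ (-1 : ℝ) hg)
  rw [hσ.flux_smul] at hneg
  exact le_antisymm (by linarith) (hu.flux_nonneg hσ hg)

end IsMinimizer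

theorem IsConductivity.exists_dnMap_apply_self_eq_energy (hσ : IsConductivity Ω σ a b) (hd : 0 < d)
    (hΩ : IsOpen Ω) (hΩb : Bornology.IsBounded Ω) (f : BoundarySpace Ω p) :
    ∃ u, IsMinimizer Ω p σ f u ∧ dnMap Ω p σ f f = energy Ω p σ u := by
  have hex : ∃ L : StrongDual ℝ (BoundarySpace Ω p), ∃ u : W1p Ω p, IsMinimizer Ω p σ f u ∧
      ∀ g : W1p Ω p, L (boundaryValue Ω p g) = flux Ω p σ u g := by
    obtain ⟨u, hu⟩ := hσ.exists_isMinimizer hd hΩ hΩb f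
    obtain ⟨L, hL⟩ := hσ.exists_clm_flux u
    refine ⟨(W01p Ω p).liftQL L fun g hg => ?_, u, hu, hL⟩
    exact (hL g).trans (hu.flux_eq_zero hσ hg)
  obtain ⟨u, hu, hdn⟩ := Classical.epsilon_spec hex
  exact ⟨u, hu, (congrArg _ hu.1.symm).trans ((hdn u).trans (flux_self u))⟩

theorem IsConductivity.isMinimizer_of_flux_eq_zero (hσ : IsConductivity Ω σ a b) {u : W1p Ω p}
    (hu : ∀ g ∈ W01p Ω p, flux Ω p σ u g = 0) :
    IsMinimizer Ω p σ (boundaryValue Ω p u) u := by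
  refine ⟨rfl, fun v hv => ?_⟩
  have h := hσ.energy_add_flux_le_energy u v
  rwa [hu _ (boundaryValue_eq_iff.1 hv), mul_zero, add_zero] at h

end Energy

/-! ### Wolff solutions are `p`-harmonic -/

section Wolff

variable {d : ℕ} {p : ℝ} {w : ℝ → ℝ} {t τ : ℝ} {ρ ρ' : E d}

/-- An orthonormal pair `ρ, ρ^⊥` of directions. -/
structure IsOrthonormalPair (ρ ρ' : E d) : Prop where
  norm_left : ‖ρ‖ = 1
  norm_right : ‖ρ'‖ = 1
  inner_eq_zero : inner ℝ ρ ρ' = 0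

/-- The function `x ↦ e^{k (ρ · x - t)} α(τ ρ^⊥ · x)`. The Wolff solutions have `k = τ`, whereas
`k = (p - 1) τ` in the components of `|∇f|^{p-2} ∇f` for a Wolff solution `f`. -/
noncomputable def expWave (k t τ : ℝ) (ρ ρ' : E d) (α : ℝ → ℝ) (x : E d) : ℝ :=
  Real.exp (k * (inner ℝ ρ x - t)) * α (τ * inner ℝ ρ' x)

theorem contDiff_expWave (k t τ : ℝ) (ρ ρ' : E d) {α : ℝ → ℝ} (hα : ContDiff ℝ 1 α) :
    ContDiff ℝ 1 (expWave k t τ ρ ρ' α) := by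
  have hinner (e : E d) : ContDiff ℝ 1 fun x : E d => inner ℝ e x :=
    contDiff_const.inner ℝ contDiff_id
  exact ((contDiff_const.mul ((hinner ρ).sub contDiff_const)).exp).mul
    (hα.comp (contDiff_const.mul (hinner ρ')))

theorem fderiv_expWave_apply (k t : ℝ) {α : ℝ → ℝ} {α' : ℝ} {x : E d}
    (hα : HasDerivAt α α' (τ * inner ℝ ρ' x)) (v : E d) :
    fderiv ℝ (expWave k t τ ρ ρ' α) x v = Real.exp (k * (inner ℝ ρ x - t)) *
      (k * α (τ * inner ℝ ρ' x) * inner ℝ ρ v + τ * α' * inner ℝ ρ' v) := by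
  have hinner (e : E d) : HasFDerivAt (fun x : E d => inner ℝ e x) (innerSL ℝ e) x :=
    (innerSL ℝ e).hasFDerivAt
  have hexp := (((hinner ρ).sub_const t).const_mul k).exp
  have hprofile := hα.comp_hasFDerivAt x ((hinner ρ').const_mul τ)
  have hwave : fderiv ℝ (expWave k t τ ρ ρ' α) x = _ := (hexp.mul hprofile).fderiv
  simp only [hwave, add_apply, smul_apply, smul_eq_mul, Function.comp, innerSL_apply_apply]
  ring

theorem IsWolffProfile.contDiff_wolffSolution (hw : IsWolffProfile p w) (t τ : ℝ) (ρ ρ' : E d) :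
    ContDiff ℝ 1 (wolffSolution w t ρ ρ' τ) :=
  contDiff_expWave τ t τ ρ ρ' (hw.1.of_le (by norm_num))

theorem IsWolffProfile.gradient_wolffSolution (hw : IsWolffProfile p w) (t τ : ℝ) (ρ ρ' x : E d) :
    gradient (wolffSolution w t ρ ρ' τ) x = (τ * Real.exp (τ * (inner ℝ ρ x - t))) •
      (w (τ * inner ℝ ρ' x) • ρ + deriv w (τ * inner ℝ ρ' x) • ρ') := by
  refine ext_inner_right ℝ fun v => ?_
  rw [← fderiv_apply_eq_inner_gradient]
  refine (fderiv_expWave_apply τ t (hw.hasDerivAt _) v).trans ?_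
  simp only [inner_add_left, real_inner_smul_left]
  ring

theorem isOrthonormalPair_iff :
    IsOrthonormalPair ρ ρ' ↔ ‖ρ‖ = 1 ∧ ‖ρ'‖ = 1 ∧ inner ℝ ρ ρ' = 0 :=
  ⟨fun h => ⟨h.norm_left, h.norm_right, h.inner_eq_zero⟩, fun h => ⟨h.1, h.2.1, h.2.2⟩⟩

theorem IsOrthonormalPair.norm_smul_add_smul_sq (hρ : IsOrthonormalPair ρ ρ') (a b : ℝ) :
    ‖a • ρ + b • ρ'‖ ^ 2 = a ^ 2 + b ^ 2 := by
  rw [norm_add_sq_real, norm_smul, norm_smul, hρ.norm_left, hρ.norm_right, real_inner_smul_left,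
    real_inner_smul_right, hρ.inner_eq_zero, mul_one, mul_one, Real.norm_eq_abs, Real.norm_eq_abs,
    sq_abs, sq_abs]
  ring

theorem IsWolffProfile.norm_gradient_wolffSolution_rpow (hw : IsWolffProfile p w)
    (hρ : IsOrthonormalPair ρ ρ') (hτ : 0 < τ) (q : ℝ) (x : E d) :
    ‖gradient (wolffSolution w t ρ ρ' τ) x‖ ^ q =
      τ ^ q * Real.exp (q * τ * (inner ℝ ρ x - t)) * radiusSq w (τ * inner ℝ ρ' x) ^ (q / 2) := by
  have hR : ‖w (τ * inner ℝ ρ' x) • ρ + deriv w (τ * inner ℝ ρ' x) • ρ'‖ ^ q =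
      radiusSq w (τ * inner ℝ ρ' x) ^ (q / 2) := by
    rw [radiusSq, ← hρ.norm_smul_add_smul_sq, ← Real.rpow_natCast,
      ← Real.rpow_mul (norm_nonneg _)]
    congr 1
    push_cast
    ring
  rw [hw.gradient_wolffSolution, norm_smul, Real.norm_of_nonneg (by positivity),
    Real.mul_rpow (by positivity) (norm_nonneg _), hR, Real.mul_rpow hτ.le (Real.exp_pos _).le,
    ← Real.exp_mul]
  ring_nf

theorem IsWolffProfile.norm_rpow_smul_gradient_wolffSolution (hw : IsWolffProfile p w)
    (hρ : IsOrthonormalPair ρ ρ') (hτ : 0 < τ) (x : E d) :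
    ‖gradient (wolffSolution w t ρ ρ' τ) x‖ ^ (p - 2) • gradient (wolffSolution w t ρ ρ' τ) x =
      τ ^ (p - 1) •
        (expWave ((p - 1) * τ) t τ ρ ρ' (fun s => radiusSq w s ^ ((p - 2) / 2) * w s) x • ρ +
        expWave ((p - 1) * τ) t τ ρ ρ' (fun s => radiusSq w s ^ ((p - 2) / 2) * deriv w s) x •
          ρ') := by
  have hexp : Real.exp ((p - 1) * τ * (inner ℝ ρ x - t)) =
      Real.exp ((p - 2) * τ * (inner ℝ ρ x - t)) * Real.exp (τ * (inner ℝ ρ x - t)) := by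
    rw [← Real.exp_add]
    ring_nf
  have hτp : τ ^ (p - 1) = τ ^ (p - 2) * τ := by
    rw [← Real.rpow_add_one hτ.ne']
    ring_nf
  rw [hw.norm_gradient_wolffSolution_rpow hρ hτ, hw.gradient_wolffSolution]
  simp only [expWave, hexp, hτp]
  module

theorem IsWolffProfile.fderiv_expWave_add_eq_zero (hw : IsWolffProfile p w) (hp : 1 < p)
    (hρ : IsOrthonormalPair ρ ρ') (t τ : ℝ) (x : E d) :
    fderiv ℝ (expWave ((p - 1) * τ) t τ ρ ρ' fun s => radiusSq w s ^ ((p - 2) / 2) * w s) x ρ +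
      fderiv ℝ (expWave ((p - 1) * τ) t τ ρ ρ'
        fun s => radiusSq w s ^ ((p - 2) / 2) * deriv w s) x ρ' = 0 := by
  have hα := ((hw.contDiff_radiusSq_rpow hp ((p - 2) / 2)).differentiable one_ne_zero
    (τ * inner ℝ ρ' x)).hasDerivAt.mul (hw.hasDerivAt (τ * inner ℝ ρ' x))
  rw [fderiv_expWave_apply _ _ (hw.hasDerivAt_rpow_mul_deriv hp _)]
  refine (congrArg (· + _) (fderiv_expWave_apply _ _ hα _)).trans ?_
  simp only [Pi.mul_apply, real_inner_self_eq_norm_sq, hρ.norm_left, hρ.norm_right,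
    hρ.inner_eq_zero, real_inner_comm ρ ρ']
  ring

variable {Ω : Set (E d)}

theorem IsTestFunction.integral_eq_zero_of_fderiv_add_eq_zero {φ A B : E d → ℝ}
    (hφ : IsTestFunction Ω φ) (hA : ContDiff ℝ 1 A) (hB : ContDiff ℝ 1 B) {v v' : E d}
    (hdiv : ∀ x, fderiv ℝ A x v + fderiv ℝ B x v' = 0) :
    ∫ x in Ω, (A x * fderiv ℝ φ x v + B x * fderiv ℝ φ x v') = 0 := by
  have hint {F : E d → ℝ} (hF : ContDiff ℝ 1 F) (e : E d) :
      IntegrableOn (fun x => F x * fderiv ℝ φ x e) Ω :=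
    ((hF.continuous.mul (hφ.continuous_fderiv_apply e)).integrable_of_hasCompactSupport
      (hφ.hasCompactSupport_fderiv_apply e).mul_left).integrableOn
  have hint' {F : E d → ℝ} (hF : ContDiff ℝ 1 F) (e : E d) :
      IntegrableOn (fun x => fderiv ℝ F x e * φ x) Ω :=
    ((((hF.continuous_fderiv one_ne_zero).clm_apply continuous_const).mul
      hφ.1.continuous).integrable_of_hasCompactSupport hφ.2.1.mul_left).integrableOn
  have hparts {F : E d → ℝ} (hF : ContDiff ℝ 1 F) (e : E d) :
      ∫ x in Ω, F x * fderiv ℝ φ x e = -∫ x in Ω, fderiv ℝ F x e * φ x := by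
    simpa only [← fderiv_apply_eq_inner_gradient] using isWeakGradient_gradient hF φ hφ e
  rw [integral_add (hint hA v) (hint hB v'), hparts hA, hparts hB, ← neg_add,
    ← integral_add (hint' hA v) (hint' hB v')]
  simp only [← add_mul, hdiv, zero_mul, integral_zero, neg_zero]

theorem IsWolffProfile.integral_inner_gradient_eq_zero (hw : IsWolffProfile p w) (hp : 1 < p)
    (hρ : IsOrthonormalPair ρ ρ') (hτ : 0 < τ) {φ : E d → ℝ} (hφ : IsTestFunction Ω φ) :
    ∫ x in Ω, ‖gradient (wolffSolution w t ρ ρ' τ) x‖ ^ (p - 2) *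
      inner ℝ (gradient (wolffSolution w t ρ ρ' τ) x) (gradient φ x) = 0 := by
  have hR := hw.contDiff_radiusSq_rpow hp ((p - 2) / 2)
  have hA := contDiff_expWave ((p - 1) * τ) t τ ρ ρ' (hR.mul (hw.1.of_le (by norm_num)))
  have hB := contDiff_expWave ((p - 1) * τ) t τ ρ ρ' (hR.mul hw.contDiff_deriv)
  simp only [← real_inner_smul_left, hw.norm_rpow_smul_gradient_wolffSolution hρ hτ]
  simp only [real_inner_comm (gradient φ _), ← fderiv_apply_eq_inner_gradient, map_smul, map_add,
    smul_eq_mul]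
  rw [integral_const_mul]
  refine mul_eq_zero_of_right _ ?_
  exact hφ.integral_eq_zero_of_fderiv_add_eq_zero hA hB (hw.fderiv_expWave_add_eq_zero hp hρ t τ)

theorem IsWolffProfile.flux_eq_zero [hp : Fact (1 < p)] (hw : IsWolffProfile p w)
    (hΩ : IsOpen Ω) (hΩb : Bornology.IsBounded Ω) (hρ : IsOrthonormalPair ρ ρ') (hτ : 0 < τ)
    {U : W1p Ω p} (hU : U.1.2 =ᵐ[volume.restrict Ω] gradient (wolffSolution w t ρ ρ' τ))
    {g : W1p Ω p} (hg : g ∈ W01p Ω p) : flux Ω p (fun _ => 1) U g = 0 := by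
  obtain ⟨L, hL⟩ := (IsConductivity.one (Ω := Ω)).exists_clm_flux U
  have hclosed : IsClosed {g : W1p Ω p | L g = 0} := isClosed_eq L.continuous continuous_const
  rw [← hL]
  refine closure_minimal ?_ hclosed hg
  rintro g ⟨φ, hφ, hgφ⟩
  refine (hL g).trans ?_
  rw [← hw.integral_inner_gradient_eq_zero hp.out hρ hτ hφ (t := t), flux]
  refine integral_congr_ae ?_
  filter_upwards [hU, W1p.gradient_ae_eq_of_contDiff hΩ hΩb hφ.contDiff_one hgφ] with x hUx hgx
  rw [hUx, hgx, one_mul]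

theorem IsWolffProfile.exists_isMinimizer_boundaryValueOfFun [hp : Fact (1 < p)]
    (hw : IsWolffProfile p w) (hΩ : IsOpen Ω) (hΩb : Bornology.IsBounded Ω)
    (hρ : IsOrthonormalPair ρ ρ') (hτ : 0 < τ) :
    ∃ U : W1p Ω p, IsMinimizer Ω p (fun _ => 1)
        (boundaryValueOfFun Ω p (wolffSolution w t ρ ρ' τ)) U ∧
      U.1.2 =ᵐ[volume.restrict Ω] gradient (wolffSolution w t ρ ρ' τ) := by
  have hsmooth := hw.contDiff_wolffSolution t τ ρ ρ'
  have hex : ∃ u : W1p Ω p, u.1.1 =ᵐ[volume.restrict Ω] wolffSolution w t ρ ρ' τ :=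
    (W1p.exists_ae_eq_of_contDiff hΩb hsmooth).imp fun _ hu => hu.1
  have hgrad := W1p.gradient_ae_eq_of_contDiff hΩ hΩb hsmooth hex.choose_spec
  have hmin := IsConductivity.one.isMinimizer_of_flux_eq_zero
    (fun _ hg => hw.flux_eq_zero hΩ hΩb hρ hτ hgrad hg)
  refine ⟨hex.choose, ?_, hgrad⟩
  rwa [boundaryValueOfFun, dif_pos hex]

end Wolff

/-! ### Monotonicity inequalities -/

section Monotonicity

variable {d : ℕ} {Ω D : Set (E d)} {p : ℝ} [hp : Fact (1 < p)] {σ : E d → ℝ} {a b : ℝ}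
  {f : BoundarySpace Ω p} {u v : W1p Ω p}

namespace IsConductivity

theorem integrable_rpow_neg_mul (hσ : IsConductivity Ω σ a b) {q : ℝ} (hq : 0 ≤ q)
    (G : Lp (E d) (ENNReal.ofReal p) (volume.restrict Ω)) :
    Integrable (fun x => σ x ^ (-q) * ‖G x‖ ^ p) (volume.restrict Ω) := by
  refine (integrable_norm_rpow_of_memLp (one_pos.trans hp.out) (Lp.memLp G)).bdd_mul (c := a ^ (-q))
    (hσ.aemeasurable.pow_const _).aestronglyMeasurable ?_
  filter_upwards [hσ.bounds] with x hx
  rw [Real.norm_of_nonneg (Real.rpow_nonneg (hσ.pos.le.trans hx.1) _)]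
  exact Real.rpow_le_rpow_of_nonpos hσ.pos hx.1 (neg_nonpos.2 hq)

theorem mul_flux_one_le (hσ : IsConductivity Ω σ a b) (u v : W1p Ω p) :
    p * flux Ω p (fun _ => 1) u v ≤
      (p - 1) * (∫ x in Ω, σ x ^ (-(1 / (p - 1))) * ‖u.1.2 x‖ ^ p) + energy Ω p σ v := by
  have hq : 0 ≤ 1 / (p - 1) := one_div_nonneg.2 (sub_nonneg.2 hp.out.le)
  have hu := (hσ.integrable_rpow_neg_mul hq u.1.2).const_mul (p - 1)
  have hv := hσ.integrable_energy v.1.2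
  rw [flux, energy, ← integral_const_mul, ← integral_const_mul, ← integral_add hu hv]
  refine integral_mono_ae ((one.integrable_flux u.1.2 v.1.2).const_mul p) (hu.add hv) ?_
  filter_upwards [hσ.bounds] with x hx
  simpa only [one_mul] using
    mul_norm_rpow_sub_two_mul_inner_le hp.out (hσ.pos.trans_le hx.1) (u.1.2 x) (v.1.2 x)

theorem energy_one_add_le_energy (hσ : IsConductivity Ω σ a b)
    (hu : IsMinimizer Ω p (fun _ => 1) f u) (hv : boundaryValue Ω p v = f) :
    energy Ω p (fun _ => 1) u +
        (p - 1) * ∫ x in Ω, (1 - σ x ^ (-(1 / (p - 1)))) * ‖u.1.2 x‖ ^ p ≤ energy Ω p σ v := by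
  have hflux : flux Ω p (fun _ => 1) u v = energy Ω p (fun _ => 1) u := by
    have h := hu.flux_eq_zero one (boundaryValue_eq_iff.1 (hv.trans hu.1.symm))
    rwa [one.flux_sub, flux_self, sub_eq_zero] at h
  have hq : 0 ≤ 1 / (p - 1) := one_div_nonneg.2 (sub_nonneg.2 hp.out.le)
  have hsplit : ∫ x in Ω, (1 - σ x ^ (-(1 / (p - 1)))) * ‖u.1.2 x‖ ^ p =
      energy Ω p (fun _ => 1) u - ∫ x in Ω, σ x ^ (-(1 / (p - 1))) * ‖u.1.2 x‖ ^ p := by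
    simp only [sub_mul]
    exact integral_sub (one.integrable_energy u.1.2) (hσ.integrable_rpow_neg_mul hq u.1.2)
  have hyoung := hσ.mul_flux_one_le u v
  rw [hflux] at hyoung
  rw [hsplit]
  linarith

theorem exists_dnMap_sub_eq_energy_sub (hσ : IsConductivity Ω σ a b) (hd : 0 < d) (hΩ : IsOpen Ω)
    (hΩb : Bornology.IsBounded Ω) (hu : IsMinimizer Ω p (fun _ => 1) f u) :
    ∃ v, IsMinimizer Ω p σ f v ∧ (dnMap Ω p σ f - dnMap Ω p (fun _ => 1) f) f =
      energy Ω p σ v - energy Ω p (fun _ => 1) u := by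
  obtain ⟨v, hv, hσv⟩ := hσ.exists_dnMap_apply_self_eq_energy hd hΩ hΩb f
  obtain ⟨z, hz, h1z⟩ := one.exists_dnMap_apply_self_eq_energy hd hΩ hΩb f
  have hzu : energy Ω p (fun _ => 1) z = energy Ω p (fun _ => 1) u :=
    le_antisymm (hz.2 u hu.1) (hu.2 z hz.1)
  exact ⟨v, hv, (congrArg₂ (· - ·) hσv h1z).trans (congrArg _ hzu)⟩

theorem integral_one_sub_rpow_neg_le_dnMap_sub (hσ : IsConductivity Ω σ a b) (hd : 0 < d)
    (hΩ : IsOpen Ω) (hΩb : Bornology.IsBounded Ω) (hu : IsMinimizer Ω p (fun _ => 1) f u) :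
    (p - 1) * (∫ x in Ω, (1 - σ x ^ (-(1 / (p - 1)))) * ‖u.1.2 x‖ ^ p) ≤
      (dnMap Ω p σ f - dnMap Ω p (fun _ => 1) f) f := by
  obtain ⟨v, hv, hdn⟩ := hσ.exists_dnMap_sub_eq_energy_sub hd hΩ hΩb hu
  rw [hdn]
  exact le_sub_iff_add_le'.2 (hσ.energy_one_add_le_energy hu hv.1)

theorem dnMap_sub_le_integral_sub_one (hσ : IsConductivity Ω σ a b) (hd : 0 < d)
    (hΩ : IsOpen Ω) (hΩb : Bornology.IsBounded Ω) (hu : IsMinimizer Ω p (fun _ => 1) f u) :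
    (dnMap Ω p σ f - dnMap Ω p (fun _ => 1) f) f ≤ ∫ x in Ω, (σ x - 1) * ‖u.1.2 x‖ ^ p := by
  obtain ⟨v, hv, hdn⟩ := hσ.exists_dnMap_sub_eq_energy_sub hd hΩ hΩb hu
  simp only [sub_mul]
  rw [hdn, integral_sub (hσ.integrable_energy u.1.2) (one.integrable_energy u.1.2)]
  exact sub_le_sub_right (hv.2 u hu.1) _

end IsConductivity

theorem IsConductivity.mul_setIntegral_le_dnMap_sub (hσ : IsConductivity Ω σ a b) (hd : 0 < d)
    (hΩ : IsOpen Ω) (hΩb : Bornology.IsBounded Ω) (hD : MeasurableSet D) (hDΩ : D ⊆ Ω)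
    (hσ_off : ∀ x ∈ Ω \ D, σ x = 1) {α : ℝ} (hα : 0 < α) (hσ_ge : ∀ x ∈ D, α ≤ σ x)
    (hu : IsMinimizer Ω p (fun _ => 1) f u) :
    (p - 1) * (1 - α ^ (-(1 / (p - 1)))) * (∫ x in D, ‖u.1.2 x‖ ^ p) ≤
      (dnMap Ω p σ f - dnMap Ω p (fun _ => 1) f) f := by
  have hq : 0 ≤ 1 / (p - 1) := one_div_nonneg.2 (sub_nonneg.2 hp.out.le)
  have hint := integrable_norm_rpow_of_memLp (one_pos.trans hp.out) (Lp.memLp u.1.2)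
  refine le_trans ?_ (hσ.integral_one_sub_rpow_neg_le_dnMap_sub hd hΩ hΩb hu)
  rw [mul_assoc, ← integral_const_mul, setIntegral_eq_of_subset_of_forall_sdiff_eq_zero
    hΩ.measurableSet hDΩ fun x hx => by rw [hσ_off x hx, Real.one_rpow, sub_self, zero_mul]]
  refine mul_le_mul_of_nonneg_left (setIntegral_mono_on ?_ ?_ hD fun x hx => ?_)
    (sub_nonneg.2 hp.out.le)
  · exact (IntegrableOn.mono_set hint hDΩ).const_mul _
  · simp only [sub_mul, one_mul]
    exact IntegrableOn.mono_set (hint.sub (hσ.integrable_rpow_neg_mul hq u.1.2)) hDΩ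
  · have := Real.rpow_le_rpow_of_nonpos hα (hσ_ge x hx) (neg_nonpos.2 hq)
    gcongr

theorem IsConductivity.dnMap_sub_le_mul_setIntegral (hσ : IsConductivity Ω σ a b) (hd : 0 < d)
    (hΩ : IsOpen Ω) (hΩb : Bornology.IsBounded Ω) (hD : MeasurableSet D) (hDΩ : D ⊆ Ω)
    (hσ_off : ∀ x ∈ Ω \ D, σ x = 1) {β : ℝ} (hσ_le : ∀ x ∈ D, σ x ≤ β)
    (hu : IsMinimizer Ω p (fun _ => 1) f u) :
    (dnMap Ω p σ f - dnMap Ω p (fun _ => 1) f) f ≤ (β - 1) * ∫ x in D, ‖u.1.2 x‖ ^ p := by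
  have hint := integrable_norm_rpow_of_memLp (one_pos.trans hp.out) (Lp.memLp u.1.2)
  refine (hσ.dnMap_sub_le_integral_sub_one hd hΩ hΩb hu).trans ?_
  rw [← integral_const_mul, setIntegral_eq_of_subset_of_forall_sdiff_eq_zero
    hΩ.measurableSet hDΩ fun x hx => by rw [hσ_off x hx, sub_self, zero_mul]]
  refine setIntegral_mono_on ?_ ?_ hD fun x hx => ?_
  · simp only [sub_mul, one_mul]
    exact IntegrableOn.mono_set ((hσ.integrable_energy u.1.2).sub hint) hDΩ
  · exact (IntegrableOn.mono_set hint hDΩ).const_mul _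
  · have := hσ_le x hx
    gcongr

theorem IsFiniteInclusion.exists_isConductivity (hσ : IsFiniteInclusion Ω D σ)
    (hσm : AEMeasurable σ (volume.restrict Ω)) (hΩ : IsOpen Ω) :
    ∃ a b, IsConductivity Ω σ a b := by
  obtain ⟨a, b, ha, hσD⟩ : ∃ a b, 0 < a ∧ ∀ x ∈ D, a < σ x ∧ σ x < b := by
    obtain ⟨-, ⟨a, b, ha, -, hσD⟩ | ⟨a, b, ha, hσD⟩⟩ := hσ
    exacts [⟨a, b, ha, hσD⟩, ⟨a, b, one_pos.trans ha, hσD⟩]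
  refine ⟨min a 1, max b 1, hσm, lt_min ha one_pos, ?_⟩
  filter_upwards [ae_restrict_mem hΩ.measurableSet] with x hx
  by_cases hxD : x ∈ D
  · exact ⟨min_le_of_left_le (hσD x hxD).1.le, le_max_of_le_left (hσD x hxD).2.le⟩
  · rw [hσ.1 x ⟨hx, hxD⟩]
    exact ⟨min_le_right _ _, le_max_right _ _⟩

theorem IsFiniteInclusion.exists_mul_setIntegral_le_abs_dnMap_sub_le
    (hσ : IsFiniteInclusion Ω D σ) (hσm : AEMeasurable σ (volume.restrict Ω)) (hd : 0 < d)
    (hΩ : IsOpen Ω) (hΩb : Bornology.IsBounded Ω) (hD : MeasurableSet D) (hDne : D.Nonempty)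
    (hDΩ : D ⊆ Ω) :
    ∃ c₁ c₂ : ℝ, 0 < c₁ ∧ 0 < c₂ ∧ ∀ (f : BoundarySpace Ω p) (u : W1p Ω p),
      IsMinimizer Ω p (fun _ => 1) f u →
        c₁ * (∫ x in D, ‖u.1.2 x‖ ^ p) ≤ |(dnMap Ω p σ f - dnMap Ω p (fun _ => 1) f) f| ∧
        |(dnMap Ω p σ f - dnMap Ω p (fun _ => 1) f) f| ≤ c₂ * ∫ x in D, ‖u.1.2 x‖ ^ p := by
  have hp1 : 0 < p - 1 := sub_pos.2 hp.out
  have hq : -(1 / (p - 1)) < 0 := neg_neg_iff_pos.2 (one_div_pos.2 hp1)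
  have hJ (u : W1p Ω p) : 0 ≤ ∫ x in D, ‖u.1.2 x‖ ^ p := integral_nonneg fun _ => by positivity
  obtain ⟨l, r, hσlr⟩ := hσ.exists_isConductivity hσm hΩ
  obtain ⟨x₀, hx₀⟩ := hDne
  obtain ⟨hσ_off, ⟨a, b, ha, hb, hσD⟩ | ⟨a, b, ha, hσD⟩⟩ := hσ
  · have ha1 : a < 1 := (hσD x₀ hx₀).1.trans ((hσD x₀ hx₀).2.trans hb)
    have hlow : 1 < a ^ (-(1 / (p - 1))) := Real.one_lt_rpow_of_pos_of_lt_one_of_neg ha ha1 hq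
    refine ⟨1 - b, (p - 1) * (a ^ (-(1 / (p - 1))) - 1), sub_pos.2 hb,
      mul_pos hp1 (sub_pos.2 hlow), fun f u hu => ?_⟩
    have hle := hσlr.mul_setIntegral_le_dnMap_sub hd hΩ hΩb hD hDΩ hσ_off ha
      (fun x hx => (hσD x hx).1.le) hu
    have hge := hσlr.dnMap_sub_le_mul_setIntegral hd hΩ hΩb hD hDΩ hσ_off
      (fun x hx => (hσD x hx).2.le) hu
    rw [abs_of_nonpos (hge.trans (mul_nonpos_of_nonpos_of_nonneg (sub_nonpos.2 hb.le) (hJ u)))]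
    constructor <;> linarith
  · have hb1 : 1 < b := ha.trans ((hσD x₀ hx₀).1.trans (hσD x₀ hx₀).2)
    have hlow : a ^ (-(1 / (p - 1))) < 1 := Real.rpow_lt_one_of_one_lt_of_neg ha hq
    have hc : 0 < (p - 1) * (1 - a ^ (-(1 / (p - 1)))) := mul_pos hp1 (sub_pos.2 hlow)
    refine ⟨_, b - 1, hc, sub_pos.2 hb1, fun f u hu => ?_⟩
    have hle := hσlr.mul_setIntegral_le_dnMap_sub hd hΩ hΩb hD hDΩ hσ_off (one_pos.trans ha)
      (fun x hx => (hσD x hx).1.le) hu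
    have hge := hσlr.dnMap_sub_le_mul_setIntegral hd hΩ hΩb hD hDΩ hσ_off
      (fun x hx => (hσD x hx).2.le) hu
    rw [abs_of_nonneg ((mul_nonneg hc.le (hJ u)).trans hle)]
    exact ⟨hle, hge⟩

end Monotonicity

/-! ### The enclosure method -/

section EnclosureMethod

variable {d : ℕ} {Ω D : Set (E d)} {p k : ℝ} {σ : E d → ℝ} {w : ℝ → ℝ}
  {I : ℝ → E d → E d → ℝ → ℝ}

theorem IsWolffProfile.exists_mul_expMass_le_integral_norm_gradient_rpow_le
    (hw : IsWolffProfile p w) (hp : 1 < p) (hDb : Bornology.IsBounded D) {q : ℝ} (hq : 0 ≤ q) :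
    ∃ c₁ c₂ : ℝ, 0 < c₁ ∧ 0 < c₂ ∧ ∀ ρ ρ' : E d, IsOrthonormalPair ρ ρ' → ∀ t τ : ℝ, 0 < τ →
      c₁ * (τ ^ q * expMass D ρ (q * τ) t) ≤
        ∫ x in D, ‖gradient (wolffSolution w t ρ ρ' τ) x‖ ^ q ∧
      ∫ x in D, ‖gradient (wolffSolution w t ρ ρ' τ) x‖ ^ q ≤
        c₂ * (τ ^ q * expMass D ρ (q * τ) t) := by
  obtain ⟨m, M, hm, hmM⟩ := hw.exists_radiusSq_bounds hp
  have hM : 0 < M := hm.trans_le ((hmM 0).1.trans (hmM 0).2)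
  refine ⟨m ^ (q / 2), M ^ (q / 2), by positivity, by positivity, fun ρ ρ' hρ t τ hτ => ?_⟩
  have hexp := ((integrableOn_expWeight hDb ρ (q * τ) t).const_mul (τ ^ q))
  have hgrad : IntegrableOn (fun x => ‖gradient (wolffSolution w t ρ ρ' τ) x‖ ^ q) D :=
    ((((continuous_gradient (hw.contDiff_wolffSolution t τ ρ ρ')).norm.rpow_const
      fun _ => Or.inr hq).continuousOn).integrableOn_compact hDb.isCompact_closure).mono_set
        subset_closure
  rw [expMass, ← integral_const_mul, ← integral_const_mul, ← integral_const_mul]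
  constructor
  · refine integral_mono (hexp.const_mul _) hgrad fun x => ?_
    simp only [hw.norm_gradient_wolffSolution_rpow hρ hτ, mul_comm (m ^ (q / 2))]
    gcongr
    exact (hmM _).1
  · refine integral_mono hgrad (hexp.const_mul _) fun x => ?_
    simp only [hw.norm_gradient_wolffSolution_rpow hρ hτ, mul_comm (M ^ (q / 2))]
    gcongr
    exacts [radiusSq_nonneg w _, (hmM _).2]

/-- The two-sided estimate `|I(t, ρ, ρ^⊥, τ)| ≍ τ^d ∫_D e^{k τ (ρ · x - t)} dx`, uniform in all
parameters. It holds with `k = p` for the indicator function, and it is all that the reconstruction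
of `D` uses about it. -/
def IsComparableToExpMass (D : Set (E d)) (k : ℝ) (I : ℝ → E d → E d → ℝ → ℝ) : Prop :=
  ∃ c₁ c₂ : ℝ, 0 < c₁ ∧ 0 < c₂ ∧ ∀ ρ ρ' : E d, IsOrthonormalPair ρ ρ' → ∀ t τ : ℝ, 0 < τ →
    c₁ * (τ ^ d * expMass D ρ (k * τ) t) ≤ |I t ρ ρ' τ| ∧
      |I t ρ ρ' τ| ≤ c₂ * (τ ^ d * expMass D ρ (k * τ) t)

theorem abs_indicatorFun [Fact (1 < p)] {t τ : ℝ} (hτ : 0 ≤ τ) (ρ ρ' : E d) :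
    |indicatorFun Ω p σ w t ρ ρ' τ| = τ ^ ((d : ℝ) - p) *
      |(dnMap Ω p σ (boundaryValueOfFun Ω p (wolffSolution w t ρ ρ' τ)) -
        dnMap Ω p (fun _ => 1) (boundaryValueOfFun Ω p (wolffSolution w t ρ ρ' τ)))
          (boundaryValueOfFun Ω p (wolffSolution w t ρ ρ' τ))| := by
  rw [indicatorFun, abs_mul, abs_of_nonneg (Real.rpow_nonneg hτ _)]

theorem isComparableToExpMass_indicatorFun [hp : Fact (1 < p)] (hd : 0 < d) (hΩ : IsOpen Ω)
    (hΩb : Bornology.IsBounded Ω) (hD : MeasurableSet D) (hDne : D.Nonempty) (hDΩ : D ⊆ Ω)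
    (hσm : AEMeasurable σ (volume.restrict Ω)) (hσ : IsFiniteInclusion Ω D σ)
    (hw : IsWolffProfile p w) : IsComparableToExpMass D p (indicatorFun Ω p σ w) := by
  obtain ⟨c₁, c₂, hc₁, hc₂, hdn⟩ :=
    hσ.exists_mul_setIntegral_le_abs_dnMap_sub_le (p := p) hσm hd hΩ hΩb hD hDne hDΩ
  obtain ⟨e₁, e₂, he₁, he₂, hgrad⟩ := hw.exists_mul_expMass_le_integral_norm_gradient_rpow_le
    hp.out (hΩb.subset hDΩ) (one_pos.trans hp.out).le
  refine ⟨c₁ * e₁, c₂ * e₂, mul_pos hc₁ he₁, mul_pos hc₂ he₂, fun ρ ρ' hρ t τ hτ => ?_⟩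
  obtain ⟨U, hU, hUgrad⟩ := hw.exists_isMinimizer_boundaryValueOfFun hΩ hΩb hρ hτ (t := t)
  have hUint : ∫ x in D, ‖U.1.2 x‖ ^ p = ∫ x in D, ‖gradient (wolffSolution w t ρ ρ' τ) x‖ ^ p :=
    integral_congr_ae ((ae_restrict_of_ae_restrict_of_subset hDΩ hUgrad).mono
      fun x hx => by simp only [hx])
  obtain ⟨hlow, hup⟩ := hdn _ U hU
  rw [hUint] at hlow hup
  obtain ⟨hglow, hgup⟩ := hgrad ρ ρ' hρ t τ hτ
  have hτ_pow : τ ^ d = τ ^ ((d : ℝ) - p) * τ ^ p := by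
    rw [← Real.rpow_add hτ, sub_add_cancel, Real.rpow_natCast]
  have hτ_nonneg : 0 ≤ τ ^ ((d : ℝ) - p) := Real.rpow_nonneg hτ.le _
  rw [abs_indicatorFun hτ.le, hτ_pow]
  constructor
  · calc c₁ * e₁ * (τ ^ ((d : ℝ) - p) * τ ^ p * expMass D ρ (p * τ) t)
        = τ ^ ((d : ℝ) - p) * (c₁ * (e₁ * (τ ^ p * expMass D ρ (p * τ) t))) := by ring
      _ ≤ _ := mul_le_mul_of_nonneg_left
        ((mul_le_mul_of_nonneg_left hglow hc₁.le).trans hlow) hτ_nonneg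
  · calc _ ≤ τ ^ ((d : ℝ) - p) * (c₂ * (e₂ * (τ ^ p * expMass D ρ (p * τ) t))) :=
        mul_le_mul_of_nonneg_left (hup.trans (mul_le_mul_of_nonneg_left hgup hc₂.le)) hτ_nonneg
      _ = c₂ * e₂ * (τ ^ ((d : ℝ) - p) * τ ^ p * expMass D ρ (p * τ) t) := by ring

namespace IsComparableToExpMass

theorem exists_bounds_supportFun (hI : IsComparableToExpMass D k I) (hk : 0 ≤ k)
    (hcork : HasInteriorCorkscrews D) (hDne : D.Nonempty) (hDb : Bornology.IsBounded D) :
    ∃ c C τ₀ : ℝ, 0 < c ∧ 0 < C ∧ 0 < τ₀ ∧ ∀ ρ ρ' : E d, IsOrthonormalPair ρ ρ' →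
      ∀ τ : ℝ, τ₀ ≤ τ → c < |I (supportFun D ρ) ρ ρ' τ| ∧
        |I (supportFun D ρ) ρ ρ' τ| < C * τ ^ d := by
  obtain ⟨c₁, c₂, hc₁, hc₂, hbounds⟩ := hI
  obtain ⟨c, τ₀, hc, hτ₀, hmass⟩ := hcork.exists_le_pow_mul_expMass hDne hDb hk
  refine ⟨c₁ * c / 2, c₂ * volume.real D + 1, τ₀, by positivity, by positivity, hτ₀,
    fun ρ ρ' hρ τ hτ => ?_⟩
  have hτ0 : 0 < τ := hτ₀.trans_le hτ
  obtain ⟨hlow, hup⟩ := hbounds ρ ρ' hρ (supportFun D ρ) τ hτ0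
  constructor
  · exact (half_lt_self (mul_pos hc₁ hc)).trans_le
      ((mul_le_mul_of_nonneg_left (hmass ρ hρ.norm_left τ hτ) hc₁.le).trans hlow)
  · have hmass_le : expMass D ρ (k * τ) (supportFun D ρ) ≤ volume.real D := by
      simpa only [sub_self, mul_zero, Real.exp_zero, one_mul] using
        expMass_le hDb ρ (mul_nonneg hk hτ0.le) (supportFun D ρ)
    calc |I (supportFun D ρ) ρ ρ' τ| ≤ c₂ * (τ ^ d * volume.real D) := hup.trans (by gcongr)
      _ < (c₂ * volume.real D + 1) * τ ^ d := by linarith [pow_pos hτ0 d]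

theorem tendsto_nhds_zero (hI : IsComparableToExpMass D k I) (hk : 0 < k)
    (hDb : Bornology.IsBounded D) {ρ ρ' : E d} (hρ : IsOrthonormalPair ρ ρ') {t : ℝ}
    (ht : supportFun D ρ < t) : Tendsto (fun τ => I t ρ ρ' τ) atTop (𝓝 0) := by
  obtain ⟨c₁, c₂, -, -, hbounds⟩ := hI
  have hlim := (tendsto_pow_mul_expMass_nhds_zero hDb hk ht).const_mul c₂
  rw [mul_zero] at hlim
  refine squeeze_zero_norm' ?_ hlim
  filter_upwards [eventually_gt_atTop 0] with τ hτ using (hbounds ρ ρ' hρ t τ hτ).2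

theorem tendsto_abs_atTop (hI : IsComparableToExpMass D k I) (hk : 0 < k) (hD : IsOpen D)
    (hDne : D.Nonempty) (hDb : Bornology.IsBounded D) {ρ ρ' : E d} (hρ : IsOrthonormalPair ρ ρ')
    {t : ℝ} (ht : t < supportFun D ρ) : Tendsto (fun τ => |I t ρ ρ' τ|) atTop atTop := by
  obtain ⟨c₁, c₂, hc₁, -, hbounds⟩ := hI
  refine tendsto_atTop_mono' _ ?_
    ((tendsto_pow_mul_expMass_atTop hD hDne hDb hk ht).const_mul_atTop hc₁)
  filter_upwards [eventually_gt_atTop 0] with τ hτ using (hbounds ρ ρ' hρ t τ hτ).1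

theorem convexHull_eq_interior (hI : IsComparableToExpMass D k I) (hk : 0 < k) (hd : 2 ≤ d)
    (hD : IsOpen D) (hDne : D.Nonempty) (hDb : Bornology.IsBounded D) :
    convexHull ℝ D = interior {x | ∀ ρ ρ' : E d, IsOrthonormalPair ρ ρ' → ∀ t : ℝ,
      Tendsto (fun τ => I t ρ ρ' τ) atTop (𝓝 0) → inner ℝ ρ x ≤ t} := by
  rw [convexHull_eq_interior_halfSpaces hD hDne hDb]
  congr 1
  ext x
  refine ⟨fun hx ρ ρ' hρ t hlim => ?_, fun hx ρ hρ => ?_⟩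
  · refine (hx ρ hρ.norm_left).trans (not_lt.1 fun ht => ?_)
    exact not_tendsto_nhds_of_tendsto_atTop (hI.tendsto_abs_atTop hk hD hDne hDb hρ ht) _ hlim.abs
  · obtain ⟨ρ', hρ', hρρ'⟩ := exists_unit_orthogonal (hd.trans_eq finrank_euclideanSpace_fin.symm) ρ
    exact le_of_forall_gt_imp_ge_of_dense fun t ht =>
      hx ρ ρ' ⟨hρ, hρ', hρρ'⟩ t (hI.tendsto_nhds_zero hk hDb ⟨hρ, hρ', hρρ'⟩ ht)

end IsComparableToExpMass

end EnclosureMethod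

end Enclosure

theorem mainTheorem6_general {d : ℕ} (hd : 2 ≤ d) (p : ℝ) [Fact (1 < p)]
    (Ω D : Set (Enclosure.E d)) (hΩ : IsOpen Ω) (hΩb : Bornology.IsBounded Ω)
    (hD : IsOpen D) (hDne : D.Nonempty) (hDΩ : D ⊆ Ω)
    (hDcork : Enclosure.HasInteriorCorkscrews D)
    (σ : Enclosure.E d → ℝ) (hσm : AEMeasurable σ (volume.restrict Ω))
    (hσ : Enclosure.IsFiniteInclusion Ω D σ)
    (w : ℝ → ℝ) (hw : Enclosure.IsWolffProfile p w) :
    (∃ c C τ₀ : ℝ, 0 < c ∧ 0 < C ∧ 0 < τ₀ ∧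
      ∀ ρ ρ' : Enclosure.E d, ‖ρ‖ = 1 → ‖ρ'‖ = 1 → inner ℝ ρ ρ' = 0 → ∀ τ : ℝ, τ₀ ≤ τ →
        c < |Enclosure.indicatorFun Ω p σ w (Enclosure.supportFun D ρ) ρ ρ' τ| ∧
        |Enclosure.indicatorFun Ω p σ w (Enclosure.supportFun D ρ) ρ ρ' τ| < C * τ ^ d) ∧
    (∀ ρ ρ' : Enclosure.E d, ‖ρ‖ = 1 → ‖ρ'‖ = 1 → inner ℝ ρ ρ' = 0 → ∀ t : ℝ,
      (Enclosure.supportFun D ρ < t →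
        Tendsto (fun τ => Enclosure.indicatorFun Ω p σ w t ρ ρ' τ) atTop (𝓝 0)) ∧
      (t < Enclosure.supportFun D ρ →
        Tendsto (fun τ => |Enclosure.indicatorFun Ω p σ w t ρ ρ' τ|) atTop atTop)) ∧
    convexHull ℝ D = interior {x : Enclosure.E d |
      ∀ ρ ρ' : Enclosure.E d, ‖ρ‖ = 1 → ‖ρ'‖ = 1 → inner ℝ ρ ρ' = 0 → ∀ t : ℝ,
        Tendsto (fun τ => Enclosure.indicatorFun Ω p σ w t ρ ρ' τ) atTop (𝓝 0) →
          inner ℝ ρ x ≤ t} := by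
  have hp : 0 < p := one_pos.trans (Fact.out : 1 < p)
  have hDb := hΩb.subset hDΩ
  have hI : Enclosure.IsComparableToExpMass D p (Enclosure.indicatorFun Ω p σ w) :=
    Enclosure.isComparableToExpMass_indicatorFun (two_pos.trans_le hd) hΩ hΩb hD.measurableSet
      hDne hDΩ hσm hσ hw
  have hbounds := hI.exists_bounds_supportFun hp.le hDcork hDne hDb
  have hlim (ρ ρ' : Enclosure.E d) (hρ : Enclosure.IsOrthonormalPair ρ ρ') (t : ℝ) :=
    And.intro (hI.tendsto_nhds_zero hp hDb hρ (t := t))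
      (hI.tendsto_abs_atTop hp hD hDne hDb hρ (t := t))
  have hhull := hI.convexHull_eq_interior hp hd hD hDne hDb
  simp only [Enclosure.isOrthonormalPair_iff, and_imp] at hbounds hlim hhull
  exact ⟨hbounds, hlim, hhull⟩

theorem mainTheorem6 {d : ℕ} (hd : 2 ≤ d) (p : ℝ) [Fact (1 < p)]
    (Ω D : Set (Enclosure.E d)) (hΩ : IsOpen Ω) (hΩb : Bornology.IsBounded Ω)
    (hD : IsOpen D) (hDne : D.Nonempty) (hDΩ : D ⊆ Ω)
    (hDlip : Enclosure.HasLipschitzBoundary D)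
    (σ : Enclosure.E d → ℝ) (hσm : AEMeasurable σ (volume.restrict Ω))
    (hσ : Enclosure.IsFiniteInclusion Ω D σ)
    (w : ℝ → ℝ) (hw : Enclosure.IsWolffProfile p w) :
    (∃ c C τ₀ : ℝ, 0 < c ∧ 0 < C ∧ 0 < τ₀ ∧
      ∀ ρ ρ' : Enclosure.E d, ‖ρ‖ = 1 → ‖ρ'‖ = 1 → inner ℝ ρ ρ' = 0 → ∀ τ : ℝ, τ₀ ≤ τ →
        c < |Enclosure.indicatorFun Ω p σ w (Enclosure.supportFun D ρ) ρ ρ' τ| ∧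
        |Enclosure.indicatorFun Ω p σ w (Enclosure.supportFun D ρ) ρ ρ' τ| < C * τ ^ d) ∧
    (∀ ρ ρ' : Enclosure.E d, ‖ρ‖ = 1 → ‖ρ'‖ = 1 → inner ℝ ρ ρ' = 0 → ∀ t : ℝ,
      (Enclosure.supportFun D ρ < t →
        Tendsto (fun τ => Enclosure.indicatorFun Ω p σ w t ρ ρ' τ) atTop (𝓝 0)) ∧
      (t < Enclosure.supportFun D ρ →
        Tendsto (fun τ => |Enclosure.indicatorFun Ω p σ w t ρ ρ' τ|) atTop atTop)) ∧
    convexHull ℝ D = interior {x : Enclosure.E d |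
      ∀ ρ ρ' : Enclosure.E d, ‖ρ‖ = 1 → ‖ρ'‖ = 1 → inner ℝ ρ ρ' = 0 → ∀ t : ℝ,
        Tendsto (fun τ => Enclosure.indicatorFun Ω p σ w t ρ ρ' τ) atTop (𝓝 0) →
          inner ℝ ρ x ≤ t} := by
  exact mainTheorem6_general hd p Ω D hΩ hΩb hD hDne hDΩ
    (hDlip.hasInteriorCorkscrews (hΩb.subset hDΩ)) σ hσm hσ w hw
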